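/- **Setting.** Let $I=\mathbb Z\times\{+1,-1\}$, $\langle (j,\sigma)\rangle=\max(|j|,1)$, $\mathfrak m_{(j,\sigma)}=\sigma j$, and let $\mathbb N^I_{\rm fin}$, $\mathbb Z^I_{\rm fin}$ be the finitely supported vectors. Put $|x|_s=\big(\sum_{k\in I}\langle k\rangle^2e^{2s\sqrt{\langle k\rangle}}|x_k|^2\big)^{1/2}$. For $s\ge 0$, $r>0$ let $\mathcal V_{s,r}$ be the space of vector fields $V=\sum_{k,q}V^{(k)}_q x^q\partial_{x_k}$ (power series, $q\in\mathbb N^I_{\rm fin}$) with $V(0)=0$, $V^{(k)}_q=0$ unless $\mathfrak m\cdot q=\mathfrak m_k$, and $\|V\|_{s,r}=\frac1r\sup_{|x|_s<r}\big|\big(\sum_q|V_q^{(k)}|\,|x|^q\big)_k\big|_s<\infty$, where $|x|^q=\prod_i|x_i|^{q_i}$. The degree of $x^q\partial_{x_k}$ is $\|q\|_{\ell^1}-1$, and $\mathcal V^{\ge d}_{s,r}$ consists of the fields with monomials of degree $\ge d$ only. Brackets $[X,Y]=\sum_j(X[Y^{(j)}]-Y[X^{(j)}])\partial_{x_j}$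 are taken in the sense of formal power series. For $\lambda\in\mathbb C^I$ let $D(\lambda)=\sum_k\lambda_kx_k\partial_{x_k}$, let $\mathcal K$ be the set of (momentum preserving) $V$ with $[D(\lambda),V]=0$, and $\mathcal K^{\rm diag}$ the set of $V\in\mathcal K$ containing only monomials $x^px_k\partial_{x_k}$, $p\in\mathbb N^I_{\rm fin}$. Let $\mathcal M_\lambda=\{Q\in\mathbb N^I_{\rm fin}: Q\cdot\lambda=0,\ Q\cdot\mathfrak m=0\}$, $\Delta^{(k)}_\lambda=\{P\in\mathbb Z^I_{\rm fin}: P\cdot\lambda=0,\ P\cdot\mathfrak m=0,\ P+e_k\in\mathbb N^I_{\rm fin}\}$, $\Delta_\lambda=\bigcup_k\Delta_\lambda^{(k)}$. Let $(Q_i)$ be the generators (indecomposable nonzero elements) of $\mathcal M_\lambda$, and $(P_j)$ the generators of $\Delta_\lambda\setminus\mathcal M_\lambda$, i.e. its elements not of the form $P'+Q$ with $P'\in\Delta_\lambda\setminus\mathcal M_\lambda$, $0\ne Q\in\mathcal M_\lambda$. Let $\mathcal J^{(1)}$ (resp. $\mathcal J^{(2)}$) be the set of $q\in\mathbb N^I_{\rm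 fin}$ with $q\ge Q_i$ for some $i$ (resp. $q\ge Q_i+Q_j$ for some $i,j$), componentwise. Let $\mathcal I^{(0)}$, $\mathcal I^{(1)}$ be the sets of (momentum preserving) vector fields containing only monomials $x^q\partial_{x_k}$ with $q\notin\mathcal J^{(1)}$, resp. $q\in\mathcal J^{(1)}\setminus\mathcal J^{(2)}$, and $\Pi^{\mathcal I^{(i)}}$ the corresponding projections on monomials. **Assumptions on $\lambda$.** (a) $\lambda_k\ne0$ for all $k$, and for some integers $M\ge1$, $M_1\ge 0$: $\|Q_i\|_{\ell^1}\le M$ for all $i$, and $\|P_j+e_k\|_{\ell^1}\le M_1$ whenever $P_j\in\Delta_\lambda^{(k)}$. (b) There are real $\varphi_k$ with $|\lambda_k-\langle k\rangle^2e^{{\rm i}\varphi_k}|\le\frac12$ for all $k$, and $|e^{{\rm i}\varphi_{(j,\sigma)}}-e^{{\rm i}\varphi_{(-j,-\sigma)}}|\ge C$ whenever $\lambda_{(j,\sigma)}\ne\lambda_{(-j,-\sigma)}$, where $C>0$. (c) $\lambda$ is $(\gamma,\tau)$-Diophantine modulo $\Delta_\lambda$, $\gamma>0$: $|\lambda\cdot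 p|\ge\gamma\prod_{i\in I}(1+p_i^2\langle i\rangle^2)^{-\tau}$ for all $p\in\mathbb Z^I_{\rm fin}\setminus\Delta_\lambda$ with $p\cdot\mathfrak m=0$ and $p+e_k\in\mathbb N^I_{\rm fin}$ for some $k$. Call $M_*\in\mathbb N$ a *threshold* for $\lambda$ if every element of $\mathcal I^{(0)}\cap\mathcal K$ or of $\mathcal I^{(1)}\cap\mathcal K$ all of whose monomials have degree $\ge M_*$ is zero. **Proposition 4.1 (Straightening the dynamics).** For every $C>0$ and $\tau\in\mathbb R$ there are constants $c,K>0$, depending only on $C$ and $\tau$, such that for all $\lambda,\gamma,M,M_1$ satisfying (a)–(c) the following holds. The number $2M+M_1$ is a threshold for $\lambda$. Moreover, let $M_*$ be any threshold for $\lambda$, $s\ge0$, $r>0$, $Z\in\mathcal K^{\rm diag}\cap\mathcal V^{\ge1}_{s,r}$, $i\in\{0,1\}$ and $Y_i\in\mathcal I^{(i)}\cap\mathcal V^{\ge M_*}_{s,r}$. Then there is $F_i$ such that for all $\sigma>0$ and $0<\rho<r$: $F_i$ belongs to $\mathcal I^{(i)}\cap\mathcal V^{\ge M_*}_{s+\sigma,r-\rho}$,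 it solves $$\Pi^{\mathcal I^{(i)}}[F_i,\,D(\lambda)+Z]=Y_i ,$$ it is the only solution in $\mathcal I^{(i)}\cap\mathcal V^{\ge M_*}_{s+\sigma,r-\rho}$, and $$\|F_i\|_{s+\sigma,r-\rho}\le K\,\frac r\rho\,\gamma^{-1}e^{2^7c/\sigma^6}\big(1+\gamma^{-1}\|Z\|_{s,r}\big)\|Y_i\|_{s,r}.$$ -/

import Mathlib

open scoped ENNReal

noncomputable section

namespace ResVF

/-! ### Indices, weights, momentum -/

/-- The index set `I = ℤ × {+1, -1}`. -/
abbrev Idx := ℤ × ℤˣ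

/-- The momentum `𝔪_{(j,σ)} = σ j`. -/
def mom (k : Idx) : ℤ := (k.2 : ℤ) * k.1

/-- `⟨(j,σ)⟩ = max(|j|, 1)`. -/
def jap (k : Idx) : ℝ := max |(k.1 : ℝ)| 1

/-- The weighted `ℓ²` norm `(∑ ⟨k⟩² e^{2 s √⟨k⟩} y_k²)^{1/2}` of a sequence of moduli. -/
def weightedNorm (s : ℝ) (y : Idx → ℝ≥0∞) : ℝ≥0∞ :=
  (∑' k, ENNReal.ofReal (jap k ^ 2 * Real.exp (2 * s * Real.sqrt (jap k))) * y k ^ 2) ^ (1 / 2 : ℝ)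

/-- The norm `|x|_s` of a complex sequence; `𝚐_s` is the set where it is finite. -/
def gNorm (s : ℝ) (x : Idx → ℂ) : ℝ≥0∞ := weightedNorm s (fun k => ‖x k‖ₑ)

/-! ### Formal vector fields and the spaces `𝒱_{s,r}` -/

/-- A formal vector field `V = ∑ V_q^{(k)} x^q ∂/∂x_k`, given by its components
`V^{(k)} ∈ ℂ⟦x_i, i ∈ I⟧`; an analytic vector field is identified with its power series. -/
abbrev FormalVF := Idx → MvPowerSeries Idx ℂ

/-- The coefficient `V_q^{(k)}` of `x^q ∂/∂x_k`. -/
def cf (V : FormalVF) (k : Idx) (q : Idx →₀ ℕ) : ℂ := MvPowerSeries.coeff q (V k)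

/-- `V_q^{(k)} = 0` unless `𝔪 · q = 𝔪_k`. -/
def MomentumPreserving (V : FormalVF) : Prop :=
  ∀ k q, cf V k q ≠ 0 → Finsupp.linearCombination ℕ mom q = mom k

/-- The majorant norm `‖V‖_{s,r} = r⁻¹ sup_{|x|_s < r} |∑ |V_q^{(k)}| x^q ∂/∂x_k|_s`, as an extended
nonnegative number. All coefficients of the majorant being nonnegative, the supremum over the
complex ball is the one over moduli, so `|x_i|` is substituted for `x_i`. -/
def majNorm (s r : ℝ) (V : FormalVF) : ℝ≥0∞ :=
  ENNReal.ofReal r⁻¹ * ⨆ (x : Idx → ℂ) (_ : gNorm s x < ENNReal.ofReal r),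
    weightedNorm s (fun k => ∑' q : Idx →₀ ℕ, ‖cf V k q‖ₑ * q.prod (fun i n => ‖x i‖ₑ ^ n))

/-- The space `𝒱_{s,r}`: `V(0) = 0`, momentum preserving, finite majorant norm. -/
structure MemV (s r : ℝ) (V : FormalVF) : Prop where
  zero : ∀ k, cf V k 0 = 0
  momentum : MomentumPreserving V
  finite : majNorm s r V < ⊤

/-- `V` has order at least `d`: only monomials `x^q ∂/∂x_k` of degree `|q| - 1 ≥ d` occur. -/
def OrderGE (d : ℕ) (V : FormalVF) : Prop :=
  ∀ k q, cf V k q ≠ 0 → d + 1 ≤ q.degree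

/-! ### Lie bracket, projections, diagonal fields -/

/-- The derivative `X[f] = ∑_k X^{(k)} ∂f/∂x_k`. If `X` is momentum preserving, then for each
`q` only finitely many `k` contribute to the coefficient of `x^q`, because for every
`a ≤ q` there are at most two `k` with `𝔪_k = 𝔪 · a`. -/
def applyVF (X : FormalVF) (f : MvPowerSeries Idx ℂ) : MvPowerSeries Idx ℂ :=
  fun q => ∑' k, MvPowerSeries.coeff q (X k * MvPowerSeries.pderiv ℂ k f)

/-- The Lie bracket `[X, Y] = ∑_j (X[Y^{(j)}] - Y[X^{(j)}]) ∂/∂x_j`. -/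
def lie (X Y : FormalVF) : FormalVF := fun j => applyVF X (Y j) - applyVF Y (X j)

open Classical in
/-- The projection keeping the monomials `x^q ∂/∂x_k` with `q ∈ J`. -/
def proj (J : Set (Idx →₀ ℕ)) (V : FormalVF) : FormalVF :=
  fun k q => if q ∈ J then cf V k q else 0

/-- `D(λ) = ∑_k λ_k x_k ∂/∂x_k`. -/
def diagField (lam : Idx → ℂ) : FormalVF :=
  fun k => MvPowerSeries.C (lam k) * MvPowerSeries.X k

/-- `V` lies in the kernel of `L_λ = [D(λ), ·]`. -/
def Resonant (lam : Idx → ℂ) (V : FormalVF) : Prop := lie (diagField lam) V = 0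

/-- `V` is diagonal: only monomials `x^p x_k ∂/∂x_k` occur. -/
def Diagonal (V : FormalVF) : Prop :=
  ∀ k q, cf V k q ≠ 0 → ∃ p : Idx →₀ ℕ, q = p + Finsupp.single k 1

/-! ### Resonances -/

/-- `ℳ_λ = {Q ∈ ℕ^I_fin : Q · λ = 0, Q · 𝔪 = 0}`. -/
def MLat (lam : Idx → ℂ) : Set (Idx →₀ ℕ) :=
  {Q | Finsupp.linearCombination ℕ lam Q = 0 ∧ Finsupp.linearCombination ℕ mom Q = 0}

/-- The generators `Q_i` of `ℳ_λ`: its indecomposable elements. -/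
def MGen (lam : Idx → ℂ) : Set (Idx →₀ ℕ) :=
  {Q | Q ∈ MLat lam ∧ Q ≠ 0 ∧
    ∀ Q₁ ∈ MLat lam, ∀ Q₂ ∈ MLat lam, Q = Q₁ + Q₂ → Q₁ = 0 ∨ Q₂ = 0}

/-- A finitely supported vector of naturals, seen in `ℤ^I_fin`. -/
def toInt (q : Idx →₀ ℕ) : Idx →₀ ℤ := q.mapRange (fun n : ℕ => (n : ℤ)) Nat.cast_zero

/-- `Δ_λ^{(k)} = {P ∈ ℤ^I_fin : P · λ = 0, P · 𝔪 = 0, P + e_k ∈ ℕ^I_fin}`. -/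
def DeltaAt (lam : Idx → ℂ) (k : Idx) : Set (Idx →₀ ℤ) :=
  {P | Finsupp.linearCombination ℤ lam P = 0 ∧ Finsupp.linearCombination ℤ mom P = 0 ∧
    0 ≤ P + Finsupp.single k 1}

/-- `Δ_λ = ⋃_k Δ_λ^{(k)}`. -/
def Delta (lam : Idx → ℂ) : Set (Idx →₀ ℤ) := ⋃ k, DeltaAt lam k

/-- `Δ_λ ∖ ℳ_λ`. -/
def DeltaOut (lam : Idx → ℂ) : Set (Idx →₀ ℤ) := Delta lam \ (toInt '' MLat lam)

/-- The generators `P_j` of `Δ_λ ∖ ℳ_λ` modulo translation by `ℳ_λ`: the elements that are not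
`P' + Q` with `P' ∈ Δ_λ ∖ ℳ_λ` and `0 ≠ Q ∈ ℳ_λ`. -/
def DeltaGen (lam : Idx → ℂ) : Set (Idx →₀ ℤ) :=
  {P | P ∈ DeltaOut lam ∧
    ∀ P' ∈ DeltaOut lam, ∀ Q ∈ MLat lam, P = P' + toInt Q → Q = 0}

/-- `‖Q_i‖_{ℓ¹} ≤ M` for all generators of `ℳ_λ`, and `‖P_j + e_k‖_{ℓ¹} ≤ M₁` for all generators
`P_j ∈ Δ_λ^{(k)}` of `Δ_λ ∖ ℳ_λ`. -/
def BoundedGenerators (lam : Idx → ℂ) (M M₁ : ℕ) : Prop :=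
  (∀ Q ∈ MGen lam, Q.degree ≤ M) ∧
  ∀ k, ∀ P ∈ DeltaGen lam, P ∈ DeltaAt lam k →
    (P + Finsupp.single k 1).sum (fun _ n => |n|) ≤ (M₁ : ℤ)

/-- Quadratic growth `|λ_k - ⟨k⟩² e^{iφ_k}| ≤ 1/2`, where the phases `e^{iφ_{(j,σ)}}` and
`e^{iφ_{(-j,-σ)}}` are at distance at least `C` whenever `λ_{(j,σ)} ≠ λ_{(-j,-σ)}`. -/
def Superlinear (C : ℝ) (lam : Idx → ℂ) : Prop :=
  ∃ φ : Idx → ℝ,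
    (∀ k, ‖lam k - (jap k : ℂ) ^ 2 * Complex.exp (Complex.I * φ k)‖ ≤ 1 / 2) ∧
    ∀ (j : ℤ) (σ : ℤˣ), lam (j, σ) ≠ lam (-j, -σ) →
      C ≤ ‖Complex.exp (Complex.I * φ (j, σ)) - Complex.exp (Complex.I * φ (-j, -σ))‖

/-- `λ` is `(γ, τ)`-Diophantine modulo `Δ_λ`. The factors with `p_i = 0` equal `1`. -/
def DiophantineMod (lam : Idx → ℂ) (γ τ : ℝ) : Prop :=
  ∀ p : Idx →₀ ℤ, p ∉ Delta lam → Finsupp.linearCombination ℤ mom p = 0 →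
    (∃ k, 0 ≤ p + Finsupp.single k 1) →
    γ * p.prod (fun i n => 1 / (1 + (n : ℝ) ^ 2 * jap i ^ 2) ^ τ)
      ≤ ‖Finsupp.linearCombination ℤ lam p‖

/-! ### The decomposition `𝒱 = ℐ⁽⁰⁾ ⊕ ℐ⁽¹⁾ ⊕ ℐ⁽²⁾` -/

/-- `𝒥⁽¹⁾`: exponents divisible by some `x^{Q_i}`. -/
def J1 (lam : Idx → ℂ) : Set (Idx →₀ ℕ) := {q | ∃ Q ∈ MGen lam, Q ≤ q}

/-- `𝒥⁽²⁾`: exponents divisible by some `x^{Q_i} x^{Q_j}`. -/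
def J2 (lam : Idx → ℂ) : Set (Idx →₀ ℕ) := {q | ∃ Q ∈ MGen lam, ∃ Q' ∈ MGen lam, Q + Q' ≤ q}

/-- The exponents of the monomials in `ℐ⁽ⁱ⁾` for `i = 0, 1`:
`𝒥⁽⁰⁾ = ℕ^I_fin ∖ 𝒥⁽¹⁾` and `𝒥⁽¹⁾ ∖ 𝒥⁽²⁾`. -/
def idealExp (lam : Idx → ℂ) : Fin 2 → Set (Idx →₀ ℕ) := ![(J1 lam)ᶜ, J1 lam \ J2 lam]

/-- `V` only involves monomials of `ℐ⁽ⁱ⁾`. -/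
def InIdeal (lam : Idx → ℂ) (i : Fin 2) (V : FormalVF) : Prop :=
  ∀ k q, cf V k q ≠ 0 → q ∈ idealExp lam i

/-- The degree threshold `M*`: `ℐ⁽⁰⁾ ∩ 𝒦^{≥ M*} = {0}` and `ℐ⁽¹⁾ ∩ 𝒦^{≥ M*} = {0}`. -/
def IsThreshold (lam : Idx → ℂ) (d : ℕ) : Prop :=
  ∀ (i : Fin 2) (V : FormalVF), MomentumPreserving V → InIdeal lam i V → Resonant lam V →
    OrderGE d V → V = 0

end ResVF

end


/-!
On `ℐ⁽ⁱ⁾` the operator `F ↦ Π [F, D(λ) + Z]` is the diagonal operator with eigenvalue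
`λ_k - λ · q` at `x^q ∂/∂x_k` plus the transport `F ↦ Π F[Z]`; the term `Z[F]` drops out because it
multiplies `F` by some `x^p` with `0 ≠ p ∈ ℳ_λ`. Two transports in a row also produce such a factor
and vanish, so the Neumann series has two terms, and the threshold makes it the only solution.

For the estimate, write `q = p + e_a` with `⟨a⟩` maximal. If the divisor is small, then momentum
conservation and the separated quadratic growth of `λ` either bound `⟨a⟩` and `⟨k⟩` polynomially in
terms of `p`, or cancel `a` against `k`. The Diophantine bound thus only sees `p`, and it is
absorbed by the gain `e^{σ (∑_i q_i √⟨i⟩ - √⟨k⟩)} ≥ e^{(σ / 2) ∑_i p_i √⟨i⟩}` which the strict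
subadditivity of the square root provides. The transport term is controlled by a Cauchy estimate.
-/

noncomputable section

namespace ResVF

open Finset.HasAntidiagonal (antidiagonal mem_antidiagonal)
open Finsupp (linearCombination single)
open MvPowerSeries (coeff pderiv)

/-! ### Derivatives along a formal vector field -/

theorem cf_sub (V W : FormalVF) (k : Idx) (q : Idx →₀ ℕ) :
    cf (V - W) k q = cf V k q - cf W k q :=
  map_sub (coeff q) (V k) (W k)

theorem FormalVF.ext_cf {V W : FormalVF} (h : ∀ k q, cf V k q = cf W k q) : V = W :=
  funext fun k => MvPowerSeries.ext (h k)

theorem finite_setOf_mom_eq (m : ℤ) : {k : Idx | mom k = m}.Finite := by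
  refine (Set.finite_range fun u : ℤˣ => ((u : ℤ) * m, u)).subset ?_
  rintro ⟨j, u⟩ rfl
  exact ⟨u, by simp [mom, ← mul_assoc, ← Units.val_mul]⟩

theorem summable_coeff_mul {X : FormalVF} (hX : MomentumPreserving X)
    (g : Idx → MvPowerSeries Idx ℂ) (q : Idx →₀ ℕ) :
    Summable fun k => coeff q (X k * g k) := by
  classical
  refine summable_of_hasFiniteSupport <| ((antidiagonal q).finite_toSet.biUnion fun a _ =>
    finite_setOf_mom_eq (linearCombination ℕ mom a.1)).subset fun k hk => ?_
  rw [Function.mem_support, MvPowerSeries.coeff_mul] at hk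
  obtain ⟨a, ha, hne⟩ := Finset.exists_ne_zero_of_sum_ne_zero hk
  exact Set.mem_biUnion ha (hX k a.1 (left_ne_zero_of_mul hne)).symm

/-- The field `X[W] = ∑_j X[W^{(j)}] ∂/∂x_j`, so that `[X, Y] = X[Y] - Y[X]`. -/
def applyField (X W : FormalVF) : FormalVF := fun j => applyVF X (W j)

theorem cf_applyField (X W : FormalVF) (j : Idx) (q : Idx →₀ ℕ) :
    cf (applyField X W) j q = ∑' k, coeff q (X k * pderiv ℂ k (W j)) := rfl

theorem cf_lie (X W : FormalVF) (j : Idx) (q : Idx →₀ ℕ) :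
    cf (lie X W) j q = cf (applyField X W) j q - cf (applyField W X) j q := rfl

theorem applyField_sub_left {X X' : FormalVF} (hX : MomentumPreserving X)
    (hX' : MomentumPreserving X') (W : FormalVF) :
    applyField (X - X') W = applyField X W - applyField X' W := by
  refine FormalVF.ext_cf fun j q => ?_
  simp only [cf_sub, cf_applyField, Pi.sub_apply, sub_mul, map_sub]
  exact (summable_coeff_mul hX _ q).tsum_sub (summable_coeff_mul hX' _ q)

theorem cf_applyField_add_left {X X' : FormalVF} (hX : MomentumPreserving X)
    (hX' : MomentumPreserving X') (W : FormalVF) (j : Idx) (q : Idx →₀ ℕ) :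
    cf (applyField (X + X') W) j q = cf (applyField X W) j q + cf (applyField X' W) j q := by
  simp only [cf_applyField, Pi.add_apply, add_mul, map_add]
  exact (summable_coeff_mul hX _ q).tsum_add (summable_coeff_mul hX' _ q)

theorem cf_applyField_add_right {X : FormalVF} (hX : MomentumPreserving X) (W W' : FormalVF)
    (j : Idx) (q : Idx →₀ ℕ) :
    cf (applyField X (W + W')) j q = cf (applyField X W) j q + cf (applyField X W') j q := by
  simp only [cf_applyField, Pi.add_apply, mul_add, map_add]
  exact (summable_coeff_mul hX _ q).tsum_add (summable_coeff_mul hX _ q)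

theorem exists_of_cf_applyField_ne_zero {X W : FormalVF} {j : Idx} {q : Idx →₀ ℕ}
    (h : cf (applyField X W) j q ≠ 0) :
    ∃ k a b, cf X k a ≠ 0 ∧ cf W j (b + single k 1) ≠ 0 ∧ a + b = q := by
  classical
  obtain ⟨k, hk⟩ : ∃ k, coeff q (X k * pderiv ℂ k (W j)) ≠ 0 := by
    by_contra! hc
    exact h ((tsum_congr hc).trans tsum_zero)
  rw [MvPowerSeries.coeff_mul] at hk
  obtain ⟨a, ha, hne⟩ := Finset.exists_ne_zero_of_sum_ne_zero hk
  rw [MvPowerSeries.coeff_pderiv] at hne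
  exact ⟨k, a.1, a.2, left_ne_zero_of_mul hne,
    left_ne_zero_of_mul (right_ne_zero_of_mul hne), mem_antidiagonal.mp ha⟩

theorem MomentumPreserving.applyField {X W : FormalVF} (hX : MomentumPreserving X)
    (hW : MomentumPreserving W) : MomentumPreserving (applyField X W) := by
  intro j q hq
  obtain ⟨k, a, b, ha, hb, rfl⟩ := exists_of_cf_applyField_ne_zero hq
  have ha' := hX k a ha
  have hb' := hW j _ hb
  rw [map_add, Finsupp.linearCombination_single, one_smul] at hb'
  rw [map_add, ha', add_comm, hb']

theorem OrderGE.applyField {d : ℕ} {X : FormalVF} (hX : OrderGE d X) (W : FormalVF) :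
    OrderGE d (applyField X W) := by
  intro j q hq
  obtain ⟨k, a, b, ha, -, rfl⟩ := exists_of_cf_applyField_ne_zero hq
  exact (hX k a ha).trans ((Nat.le_add_right _ _).trans_eq (map_add _ _ _).symm)

/-! ### The diagonal field -/

theorem coeff_X_mul_pderiv {ι R : Type*} [CommSemiring R] (k : ι) (f : MvPowerSeries ι R)
    (q : ι →₀ ℕ) : coeff q (MvPowerSeries.X k * pderiv R k f) = q k * coeff q f := by
  classical
  by_cases hq : q k = 0
  · rw [hq, MvPowerSeries.X_def, MvPowerSeries.coeff_monomial_mul, if_neg, Nat.cast_zero, zero_mul]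
    simp [Finsupp.single_le_iff, hq]
  · rw [← Finsupp.sub_add_single_one_cancel hq, add_comm, MvPowerSeries.X_def,
      MvPowerSeries.coeff_add_monomial_mul, one_mul, MvPowerSeries.coeff_pderiv,
      add_comm (single _ _)]
    simp [mul_comm]

/-- The small divisor `λ_k - λ · q` of the monomial `x^q ∂/∂x_k`. -/
def divisor (lam : Idx → ℂ) (k : Idx) (q : Idx →₀ ℕ) : ℂ := lam k - linearCombination ℕ lam q

variable {lam : Idx → ℂ}

theorem divisor_add_single (p : Idx →₀ ℕ) (a k : Idx) :
    divisor lam k (p + single a 1) = lam k - lam a - linearCombination ℕ lam p := by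
  simp only [divisor, map_add, Finsupp.linearCombination_single, one_smul]
  ring

theorem momentumPreserving_diagField (lam : Idx → ℂ) : MomentumPreserving (diagField lam) := by
  intro k q h
  obtain rfl : q = single k 1 := by
    by_contra hq
    simp [cf, diagField, MvPowerSeries.coeff_X, hq] at h
  simp

theorem cf_applyField_diagField_left (lam : Idx → ℂ) (V : FormalVF) (j : Idx) (q : Idx →₀ ℕ) :
    cf (applyField (diagField lam) V) j q = linearCombination ℕ lam q * cf V j q := by
  have h (k : Idx) : coeff q (diagField lam k * pderiv ℂ k (V j)) = q k • lam k * cf V j q := by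
    rw [diagField, mul_assoc, MvPowerSeries.coeff_C_mul, coeff_X_mul_pderiv, nsmul_eq_mul, cf]
    ring
  rw [cf_applyField, tsum_congr h, tsum_eq_sum (s := q.support), Finsupp.linearCombination_apply,
    Finsupp.sum, Finset.sum_mul]
  intro k hk
  simp [Finsupp.notMem_support_iff.mp hk]

theorem cf_applyField_diagField_right (X : FormalVF) (lam : Idx → ℂ) (j : Idx) (q : Idx →₀ ℕ) :
    cf (applyField X (diagField lam)) j q = lam j * cf X j q := by
  have h (k : Idx) :
      pderiv ℂ k (diagField lam j) =
        MvPowerSeries.C (lam j) * Pi.single (M := fun _ => MvPowerSeries Idx ℂ) k 1 j := by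
    rw [diagField, Derivation.leibniz, MvPowerSeries.pderiv_C, smul_zero, add_zero, smul_eq_mul,
      MvPowerSeries.pderiv_X]
  rw [cf_applyField, tsum_eq_single j]
  · rw [h, Pi.single_eq_same, mul_one, mul_comm, MvPowerSeries.coeff_C_mul, cf]
  · intro k hk
    rw [h, Pi.single_eq_of_ne hk.symm, mul_zero, mul_zero, map_zero]

theorem resonant_iff {V : FormalVF} :
    Resonant lam V ↔ ∀ k q, cf V k q ≠ 0 → divisor lam k q = 0 := by
  have h (k : Idx) (q : Idx →₀ ℕ) :
      cf (lie (diagField lam) V) k q = -divisor lam k q * cf V k q := by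
    rw [cf_lie, cf_applyField_diagField_left, cf_applyField_diagField_right, divisor]
    ring
  constructor
  · intro hV k q hq
    have h0 : -divisor lam k q * cf V k q = 0 := by
      rw [← h, show lie (diagField lam) V = 0 from hV]
      exact map_zero _
    exact neg_eq_zero.mp ((mul_eq_zero.mp h0).resolve_right hq)
  · refine fun hV => FormalVF.ext_cf fun k q => (h k q).trans ?_
    by_cases hq : cf V k q = 0
    · rw [hq, mul_zero]
      exact (map_zero _).symm
    · rw [hV k q hq, neg_zero, zero_mul]
      exact (map_zero _).symm

/-! ### Resonance lattices -/

theorem zero_mem_MLat (lam : Idx → ℂ) : (0 : Idx →₀ ℕ) ∈ MLat lam :=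
  ⟨map_zero _, map_zero _⟩

theorem add_mem_MLat {P Q : Idx →₀ ℕ} (hP : P ∈ MLat lam) (hQ : Q ∈ MLat lam) : P + Q ∈ MLat lam :=
  ⟨by rw [map_add, hP.1, hQ.1, add_zero], by rw [map_add, hP.2, hQ.2, add_zero]⟩

theorem mem_MLat_of_add_single {k : Idx} {p : Idx →₀ ℕ} (hdiv : divisor lam k (p + single k 1) = 0)
    (hmom : linearCombination ℕ mom (p + single k 1) = mom k) : p ∈ MLat lam :=
  ⟨by simpa [divisor] using hdiv, by simpa using hmom⟩

theorem degree_pos_of_ne_zero {q : Idx →₀ ℕ} (h : q ≠ 0) : 0 < q.degree :=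
  Nat.pos_of_ne_zero fun h0 => h ((Finsupp.degree_eq_zero_iff q).mp h0)

theorem exists_MGen_add {P : Idx →₀ ℕ} (hP : P ∈ MLat lam) (hP0 : P ≠ 0) :
    ∃ Q ∈ MGen lam, ∃ R ∈ MLat lam, P = Q + R := by
  induction hn : P.degree using Nat.strong_induction_on generalizing P with
  | _ n ih =>
    by_cases hg : P ∈ MGen lam
    · exact ⟨P, hg, 0, zero_mem_MLat lam, (add_zero P).symm⟩
    · obtain ⟨Q₁, h₁, Q₂, h₂, rfl, h₁0, h₂0⟩ :
          ∃ Q₁ ∈ MLat lam, ∃ Q₂ ∈ MLat lam, P = Q₁ + Q₂ ∧ Q₁ ≠ 0 ∧ Q₂ ≠ 0 := by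
        by_contra! hc
        exact hg ⟨hP, hP0, fun Q₁ h₁ Q₂ h₂ h => or_iff_not_imp_left.mpr (hc Q₁ h₁ Q₂ h₂ h)⟩
      have hlt : Q₁.degree < n := by
        rw [← hn, map_add]
        exact Nat.lt_add_of_pos_right (degree_pos_of_ne_zero h₂0)
      obtain ⟨Q, hQ, R, hR, hQR⟩ := ih _ hlt h₁ h₁0 rfl
      exact ⟨Q, hQ, R + Q₂, add_mem_MLat hR h₂, by rw [hQR, add_assoc]⟩

theorem mem_J2_of_degree_lt {M : ℕ} (hM : ∀ Q ∈ MGen lam, Q.degree ≤ M) {Q q : Idx →₀ ℕ}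
    (hQ : Q ∈ MLat lam) (hdeg : M < Q.degree) (hq : Q ≤ q) : q ∈ J2 lam := by
  have hQ0 : Q ≠ 0 := by
    rintro rfl
    simp at hdeg
  obtain ⟨Q₁, h₁, R, hR, rfl⟩ := exists_MGen_add hQ hQ0
  have hR0 : R ≠ 0 := by
    rintro rfl
    exact hdeg.not_ge (by simpa using hM Q₁ h₁)
  obtain ⟨Q₂, h₂, R', -, rfl⟩ := exists_MGen_add hR hR0
  exact ⟨Q₁, h₁, Q₂, h₂, le_trans (by gcongr; exact le_self_add) hq⟩

theorem notMem_J2_of_mem_idealExp {i : Fin 2} {q : Idx →₀ ℕ} (h : q ∈ idealExp lam i) :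
    q ∉ J2 lam := by
  fin_cases i
  · exact fun ⟨Q, hQ, Q', _, hle⟩ => h ⟨Q, hQ, le_self_add.trans hle⟩
  · exact h.2

theorem notMem_idealExp_of_add_le {i : Fin 2} {a p q : Idx →₀ ℕ} (ha : a ∈ idealExp lam i)
    (hp : p ∈ MLat lam) (hp0 : p ≠ 0) (h : a + p ≤ q) : q ∉ idealExp lam i := by
  obtain ⟨Q, hQ, R, -, rfl⟩ := exists_MGen_add hp hp0
  fin_cases i
  · exact fun hq => hq ⟨Q, hQ, le_self_add.trans (le_add_self.trans h)⟩
  · obtain ⟨⟨Q', hQ', hle⟩, -⟩ := ha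
    exact fun hq => hq.2 ⟨Q', hQ', Q, hQ, (add_le_add hle le_self_add).trans h⟩

/-! ### The degree threshold -/

theorem toInt_apply (q : Idx →₀ ℕ) (k : Idx) : toInt q k = (q k : ℤ) := rfl

theorem toInt_nonneg (q : Idx →₀ ℕ) : 0 ≤ toInt q := fun k => Int.natCast_nonneg (q k)

theorem toInt_injective : Function.Injective toInt :=
  Finsupp.mapRange_injective _ Nat.cast_zero Nat.cast_injective

theorem toInt_add (a b : Idx →₀ ℕ) : toInt (a + b) = toInt a + toInt b :=
  Finsupp.mapRange_add Nat.cast_add a b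

theorem linearCombination_toInt {E : Type*} [AddCommGroup E] (v : Idx → E) (q : Idx →₀ ℕ) :
    linearCombination ℤ v (toInt q) = linearCombination ℕ v q := by
  rw [Finsupp.linearCombination_apply, Finsupp.linearCombination_apply, toInt,
    Finsupp.sum_mapRange_index (by simp)]
  simp

theorem sum_abs_toInt (q : Idx →₀ ℕ) : (toInt q).sum (fun _ n => |n|) = (q.degree : ℤ) := by
  rw [toInt, Finsupp.sum_mapRange_index (by simp), Finsupp.degree_apply]
  simp [Finsupp.sum]

theorem exists_toInt_eq {p : Idx →₀ ℤ} (h : 0 ≤ p) : ∃ q, toInt q = p := by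
  refine ⟨p.mapRange Int.toNat rfl, ?_⟩
  ext k
  simpa [toInt_apply] using h k

theorem exists_MLat_add_reduced (lam : Idx → ℂ) (q : Idx →₀ ℕ) :
    ∃ Q ∈ MLat lam, ∃ R, q = Q + R ∧ ∀ S ∈ MLat lam, S ≤ R → S = 0 := by
  induction hn : q.degree using Nat.strong_induction_on generalizing q with
  | _ n ih =>
    by_cases hred : ∀ S ∈ MLat lam, S ≤ q → S = 0
    · exact ⟨0, zero_mem_MLat lam, q, (zero_add q).symm, hred⟩
    · push Not at hred
      obtain ⟨S, hS, hle, hS0⟩ := hred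
      obtain ⟨q', rfl⟩ := exists_add_of_le hle
      have hlt : q'.degree < n := by
        rw [← hn, map_add]
        exact Nat.lt_add_of_pos_left (degree_pos_of_ne_zero hS0)
      obtain ⟨Q, hQ, R, rfl, hR⟩ := ih _ hlt q' rfl
      exact ⟨S + Q, add_mem_MLat hS hQ, R, (add_assoc S Q R).symm, hR⟩

theorem mem_DeltaAt_of_divisor_eq_zero {k : Idx} {R : Idx →₀ ℕ} (hdiv : divisor lam k R = 0)
    (hmom : linearCombination ℕ mom R = mom k) : toInt R - single k 1 ∈ DeltaAt lam k := by
  refine ⟨?_, ?_, by simpa using toInt_nonneg R⟩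
  · rw [map_sub, linearCombination_toInt, ← sub_eq_zero.mp hdiv]
    simp
  · rw [map_sub, linearCombination_toInt, hmom]
    simp

theorem mem_DeltaGen_of_reduced {k : Idx} {R : Idx →₀ ℕ} (hdiv : divisor lam k R = 0)
    (hmom : linearCombination ℕ mom R = mom k) (hk : R k = 0)
    (hred : ∀ S ∈ MLat lam, S ≤ R → S = 0) : toInt R - single k 1 ∈ DeltaGen lam := by
  have hneg : (toInt R - single k 1 : Idx →₀ ℤ) k < 0 := by simp [toInt_apply, hk]
  refine ⟨⟨Set.mem_iUnion.mpr ⟨k, mem_DeltaAt_of_divisor_eq_zero hdiv hmom⟩, ?_⟩, ?_⟩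
  · rintro ⟨S, -, hS⟩
    exact hneg.not_ge (hS ▸ toInt_nonneg S k)
  · rintro P ⟨hP, -⟩ S hS hPS
    obtain ⟨l, hl⟩ := Set.mem_iUnion.mp hP
    have hPk : P k < 0 := by
      refine lt_of_le_of_lt ?_ hneg
      rw [hPS, Finsupp.add_apply]
      exact le_add_of_nonneg_right (toInt_nonneg S k)
    obtain rfl : l = k := by
      by_contra hne
      have hPk' := hl.2.2 k
      rw [Finsupp.add_apply, Finsupp.single_eq_of_ne' hne, add_zero] at hPk'
      exact hPk.not_ge hPk'
    obtain ⟨R', hR'⟩ := exists_toInt_eq hl.2.2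
    have hRS : R = R' + S := by
      apply toInt_injective
      rw [toInt_add, hR', add_right_comm, ← hPS, sub_add_cancel]
    exact hred S hS (hRS ▸ le_add_self)

theorem mem_J2_of_divisor_eq_zero {M M₁ : ℕ} (hM0 : 0 < M) (hB : BoundedGenerators lam M M₁)
    {k : Idx} {q : Idx →₀ ℕ} (hdiv : divisor lam k q = 0)
    (hmom : linearCombination ℕ mom q = mom k) (hdeg : 2 * M + M₁ + 1 ≤ q.degree) :
    q ∈ J2 lam := by
  by_cases hqk : q k = 0
  · obtain ⟨Q, hQ, R, rfl, hR⟩ := exists_MLat_add_reduced lam q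
    have hRdiv : divisor lam k R = 0 := by simpa [divisor, hQ.1] using hdiv
    have hRmom : linearCombination ℕ mom R = mom k := by simpa [hQ.2] using hmom
    have hRk : R k = 0 := (add_eq_zero.mp hqk).2
    have hRdeg : R.degree ≤ M₁ := by
      have h := hB.2 k _ (mem_DeltaGen_of_reduced hRdiv hRmom hRk hR)
        (mem_DeltaAt_of_divisor_eq_zero hRdiv hRmom)
      rwa [sub_add_cancel, sum_abs_toInt, Nat.cast_le] at h
    rw [map_add] at hdeg
    exact mem_J2_of_degree_lt hB.1 hQ (by omega) le_self_add
  · rw [← Finsupp.sub_add_single_one_cancel hqk] at hdiv hmom hdeg ⊢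
    rw [map_add, Finsupp.degree_single] at hdeg
    exact mem_J2_of_degree_lt hB.1 (mem_MLat_of_add_single hdiv hmom) (by omega) le_self_add

theorem isThreshold_of_boundedGenerators {M M₁ : ℕ} (hM0 : 0 < M)
    (hB : BoundedGenerators lam M M₁) : IsThreshold lam (2 * M + M₁) := by
  refine fun i V hmom hI hres hord => FormalVF.ext_cf fun k q => ?_
  by_contra hc
  exact notMem_J2_of_mem_idealExp (hI k q hc)
    (mem_J2_of_divisor_eq_zero hM0 hB (resonant_iff.mp hres k q hc) (hmom k q hc) (hord k q hc))

theorem IsThreshold.divisor_ne_zero {d : ℕ} (hd : IsThreshold lam d) {i : Fin 2} {k : Idx}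
    {q : Idx →₀ ℕ} (hq : q ∈ idealExp lam i) (hmom : linearCombination ℕ mom q = mom k)
    (hdeg : d + 1 ≤ q.degree) : divisor lam k q ≠ 0 := by
  classical
  intro hdiv
  let V : FormalVF := fun j p => if j = k ∧ p = q then 1 else 0
  have hV (j p) (h : cf V j p ≠ 0) : j = k ∧ p = q := by
    by_contra hc
    exact h (if_neg hc)
  have h0 : V = 0 := by
    refine hd i V ?_ ?_ (resonant_iff.mpr ?_) ?_ <;> intro j p h <;>
      obtain ⟨rfl, rfl⟩ := hV j p h <;> assumption
  have h1 : V k q = 1 := if_pos ⟨rfl, rfl⟩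
  rw [h0] at h1
  exact zero_ne_one h1

/-! ### The homological equation -/

/-- Resonant diagonal fields of positive order, in terms of their monomials: each is
`x^p x_k ∂/∂x_k` with `0 ≠ p ∈ ℳ_λ`. -/
def ResonantDiagonal (lam : Idx → ℂ) (Z : FormalVF) : Prop :=
  ∀ k q, cf Z k q ≠ 0 → ∃ p ∈ MLat lam, p ≠ 0 ∧ q = p + single k 1

/-- The momentum preserving fields in `ℐ⁽ⁱ⁾` of order at least `d`. -/
structure IdealField (lam : Idx → ℂ) (i : Fin 2) (d : ℕ) (V : FormalVF) : Prop where
  momentum : MomentumPreserving V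
  inIdeal : InIdeal lam i V
  orderGE : OrderGE d V

/-- The off-diagonal part `F ↦ Π^{ℐ⁽ⁱ⁾} F[Z]` of the homological operator
`F ↦ Π^{ℐ⁽ⁱ⁾} [F, D(λ) + Z]`. -/
def transport (lam : Idx → ℂ) (i : Fin 2) (Z F : FormalVF) : FormalVF :=
  proj (idealExp lam i) (applyField F Z)

/-- The inverse of the diagonal part `F ↦ [F, D(λ)]` of the homological operator. Resonant
monomials are sent to `0` by the convention `x / 0 = 0`. -/
def divLam (lam : Idx → ℂ) (V : FormalVF) : FormalVF := fun k q => cf V k q / divisor lam k q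

/-- The solution of the homological equation `Π^{ℐ⁽ⁱ⁾} [F, D(λ) + Z] = Y`: the Neumann series of
the homological operator around its diagonal part, which stops after two terms. -/
def homSol (lam : Idx → ℂ) (i : Fin 2) (Z Y : FormalVF) : FormalVF :=
  divLam lam (Y - transport lam i Z (divLam lam Y))

theorem ResonantDiagonal.of_diagonal {Z : FormalVF} (hmom : MomentumPreserving Z)
    (hres : Resonant lam Z) (hdiag : Diagonal Z) (hord : OrderGE 1 Z) : ResonantDiagonal lam Z := by
  intro k q h
  obtain ⟨p, rfl⟩ := hdiag k q h
  refine ⟨p, mem_MLat_of_add_single (resonant_iff.mp hres k _ h) (hmom k _ h), ?_, rfl⟩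
  rintro rfl
  simpa using hord k _ h

theorem ResonantDiagonal.momentum {Z : FormalVF} (hZ : ResonantDiagonal lam Z) :
    MomentumPreserving Z := by
  intro k q h
  obtain ⟨p, hp, -, rfl⟩ := hZ k q h
  simp [hp.2]

theorem cf_proj_of_mem {J : Set (Idx →₀ ℕ)} {q : Idx →₀ ℕ} (hq : q ∈ J) (V : FormalVF) (k : Idx) :
    cf (proj J V) k q = cf V k q :=
  if_pos hq

theorem cf_proj_of_notMem {J : Set (Idx →₀ ℕ)} {q : Idx →₀ ℕ} (hq : q ∉ J) (V : FormalVF)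
    (k : Idx) : cf (proj J V) k q = 0 :=
  if_neg hq

theorem cf_proj_ne_zero {J : Set (Idx →₀ ℕ)} {V : FormalVF} {k : Idx} {q : Idx →₀ ℕ}
    (h : cf (proj J V) k q ≠ 0) : q ∈ J ∧ cf V k q ≠ 0 := by
  by_cases hq : q ∈ J
  · exact ⟨hq, cf_proj_of_mem hq V k ▸ h⟩
  · exact absurd (cf_proj_of_notMem hq V k) h

theorem proj_sub (J : Set (Idx →₀ ℕ)) (V W : FormalVF) :
    proj J (V - W) = proj J V - proj J W := by
  refine FormalVF.ext_cf fun k q => ?_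
  by_cases hq : q ∈ J
  · simp only [cf_sub, cf_proj_of_mem hq]
  · simp only [cf_sub, cf_proj_of_notMem hq, sub_zero]

theorem cf_divLam (V : FormalVF) (k : Idx) (q : Idx →₀ ℕ) :
    cf (divLam lam V) k q = cf V k q / divisor lam k q := rfl

theorem cf_ne_zero_of_divLam {V : FormalVF} {k : Idx} {q : Idx →₀ ℕ}
    (h : cf (divLam lam V) k q ≠ 0) : cf V k q ≠ 0 := by
  contrapose! h
  rw [cf_divLam, h, zero_div]

theorem divLam_sub (V W : FormalVF) : divLam lam (V - W) = divLam lam V - divLam lam W :=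
  FormalVF.ext_cf fun k q => by simp only [cf_divLam, cf_sub, sub_div]

namespace IdealField

variable {i : Fin 2} {d : ℕ} {V W Z : FormalVF}

theorem of_support (hV : IdealField lam i d V) (h : ∀ k q, cf W k q ≠ 0 → cf V k q ≠ 0) :
    IdealField lam i d W :=
  ⟨fun k q hq => hV.momentum k q (h k q hq), fun k q hq => hV.inIdeal k q (h k q hq),
    fun k q hq => hV.orderGE k q (h k q hq)⟩

theorem sub (hV : IdealField lam i d V) (hW : IdealField lam i d W) :
    IdealField lam i d (V - W) := by
  have h {k q} (hq : cf (V - W) k q ≠ 0) : cf V k q ≠ 0 ∨ cf W k q ≠ 0 := by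
    contrapose! hq
    rw [cf_sub, hq.1, hq.2, sub_zero]
  exact ⟨fun k q hq => (h hq).elim (hV.momentum k q) (hW.momentum k q),
    fun k q hq => (h hq).elim (hV.inIdeal k q) (hW.inIdeal k q),
    fun k q hq => (h hq).elim (hV.orderGE k q) (hW.orderGE k q)⟩

theorem divLam (hV : IdealField lam i d V) : IdealField lam i d (divLam lam V) :=
  hV.of_support fun _ _ => cf_ne_zero_of_divLam

theorem transport (hZ : MomentumPreserving Z) (hV : IdealField lam i d V) :
    IdealField lam i d (transport lam i Z V) :=
  ⟨fun k q hq => hV.momentum.applyField hZ k q (cf_proj_ne_zero hq).2,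
    fun _ _ hq => (cf_proj_ne_zero hq).1,
    fun k q hq => hV.orderGE.applyField Z k q (cf_proj_ne_zero hq).2⟩

theorem homSol (hZ : MomentumPreserving Z) (hV : IdealField lam i d V) :
    IdealField lam i d (homSol lam i Z V) :=
  (hV.sub (hV.divLam.transport hZ)).divLam

theorem cf_eq_zero_of_divisor_eq_zero (hthr : IsThreshold lam d) (hV : IdealField lam i d V)
    {k : Idx} {q : Idx →₀ ℕ} (hdiv : divisor lam k q = 0) : cf V k q = 0 := by
  by_contra h
  exact hthr.divisor_ne_zero (hV.inIdeal k q h) (hV.momentum k q h) (hV.orderGE k q h) hdiv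

end IdealField

section Homological

variable {i : Fin 2} {d : ℕ} {F W Y Z : FormalVF}

theorem cf_applyField_eq_zero_of_resonantDiagonal (hZ : ResonantDiagonal lam Z)
    (hF : InIdeal lam i F) {j : Idx} {q : Idx →₀ ℕ} (hq : q ∈ idealExp lam i) :
    cf (applyField Z F) j q = 0 := by
  by_contra hne
  obtain ⟨k, a, b, ha, hb, rfl⟩ := exists_of_cf_applyField_ne_zero hne
  obtain ⟨p, hp, hp0, rfl⟩ := hZ k a ha
  refine notMem_idealExp_of_add_le (hF j _ hb) hp hp0 (le_of_eq ?_) hq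
  rw [add_comm, add_assoc, add_comm b]

theorem cf_proj_lie (hZ : ResonantDiagonal lam Z) (hF : IdealField lam i d F) (j : Idx)
    (q : Idx →₀ ℕ) :
    cf (proj (idealExp lam i) (lie F (diagField lam + Z))) j q =
      divisor lam j q * cf F j q + cf (transport lam i Z F) j q := by
  by_cases hq : q ∈ idealExp lam i
  · rw [transport, cf_proj_of_mem hq, cf_proj_of_mem hq, cf_lie,
      cf_applyField_add_right hF.momentum,
      cf_applyField_add_left (momentumPreserving_diagField lam) hZ.momentum,
      cf_applyField_diagField_left, cf_applyField_diagField_right,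
      cf_applyField_eq_zero_of_resonantDiagonal hZ hF.inIdeal hq, divisor]
    ring
  · have hF0 : cf F j q = 0 := not_not.mp fun h => hq (hF.inIdeal j q h)
    rw [transport, cf_proj_of_notMem hq, cf_proj_of_notMem hq, hF0, mul_zero, add_zero]

theorem transport_sub (hF : MomentumPreserving F) (hW : MomentumPreserving W) :
    transport lam i Z (F - W) = transport lam i Z F - transport lam i Z W := by
  rw [transport, applyField_sub_left hF hW, proj_sub, transport, transport]

/-- If the first step keeps its direction, it multiplies by some `x^p` with `0 ≠ p ∈ ℳ_λ` and so
already leaves `ℐ⁽ⁱ⁾`. Otherwise it multiplies by the variable which the second step differentiates,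
and the two steps together multiply by at least `x^p`. -/
theorem transport_transport_eq_zero_of_support (hZ : ResonantDiagonal lam Z)
    (hF : InIdeal lam i F)
    (hW : ∀ k q, cf W k q ≠ 0 → cf (transport lam i Z F) k q ≠ 0) : transport lam i Z W = 0 := by
  refine FormalVF.ext_cf fun j q => ?_
  by_contra hne
  obtain ⟨hq, hne⟩ := cf_proj_ne_zero hne
  obtain ⟨k, a, b, ha, hb, rfl⟩ := exists_of_cf_applyField_ne_zero hne
  obtain ⟨haI, ha⟩ := cf_proj_ne_zero (hW k a ha)
  obtain ⟨l, a₁, b₁, ha₁, hb₁, rfl⟩ := exists_of_cf_applyField_ne_zero ha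
  obtain ⟨p, hp, hp0, hpb⟩ := hZ j _ hb
  obtain ⟨p₁, hp₁, hp₁0, hpb₁⟩ := hZ k _ hb₁
  have ha₁I := hF l a₁ ha₁
  by_cases hlk : l = k
  · subst hlk
    rw [add_left_injective _ hpb₁] at haI
    exact notMem_idealExp_of_add_le ha₁I hp₁ hp₁0 le_rfl haI
  · have hk : single k 1 ≤ b₁ := by
      have h := DFunLike.congr_fun hpb₁ k
      rw [Finsupp.add_apply, Finsupp.single_eq_of_ne' hlk, add_zero, Finsupp.add_apply,
        Finsupp.single_eq_same] at h
      rw [Finsupp.single_le_iff, h]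
      exact Nat.le_add_left 1 _
    refine notMem_idealExp_of_add_le ha₁I hp hp0 ?_ hq
    rw [add_assoc]
    gcongr
    calc p ≤ p + single j 1 := le_self_add
      _ = b + single k 1 := hpb.symm
      _ ≤ b + b₁ := by gcongr
      _ = b₁ + b := add_comm _ _

theorem transport_divLam_sub_transport (hZ : ResonantDiagonal lam Z) (hY : IdealField lam i d Y)
    (hF : IdealField lam i d F) :
    transport lam i Z (divLam lam (Y - transport lam i Z F)) =
      transport lam i Z (divLam lam Y) := by
  rw [divLam_sub, transport_sub hY.divLam.momentum (hF.transport hZ.momentum).divLam.momentum,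
    transport_transport_eq_zero_of_support (W := divLam lam (transport lam i Z F)) hZ hF.inIdeal
      fun _ _ => cf_ne_zero_of_divLam, sub_zero]

theorem proj_lie_eq_iff_eq_divLam (hthr : IsThreshold lam d) (hZ : ResonantDiagonal lam Z)
    (hF : IdealField lam i d F) (hY : IdealField lam i d Y) :
    proj (idealExp lam i) (lie F (diagField lam + Z)) = Y ↔
      F = divLam lam (Y - transport lam i Z F) := by
  have h (k : Idx) (q : Idx →₀ ℕ) :
      cf (proj (idealExp lam i) (lie F (diagField lam + Z))) k q = cf Y k q ↔
        cf F k q = cf (divLam lam (Y - transport lam i Z F)) k q := by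
    rw [cf_proj_lie hZ hF, cf_divLam, cf_sub]
    by_cases hdiv : divisor lam k q = 0
    · have hzero {V : FormalVF} (hV : IdealField lam i d V) : cf V k q = 0 :=
        hV.cf_eq_zero_of_divisor_eq_zero hthr hdiv
      rw [hzero hF, hzero hY, hzero (hF.transport hZ.momentum)]
      simp
    · rw [eq_div_iff hdiv, eq_sub_iff_add_eq, mul_comm]
  exact ⟨fun hE => FormalVF.ext_cf fun k q => (h k q).mp (by rw [hE]),
    fun hE => FormalVF.ext_cf fun k q => (h k q).mpr (by rw [← hE])⟩

theorem proj_lie_eq_iff_eq_homSol (hthr : IsThreshold lam d) (hZ : ResonantDiagonal lam Z)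
    (hF : IdealField lam i d F) (hY : IdealField lam i d Y) :
    proj (idealExp lam i) (lie F (diagField lam + Z)) = Y ↔ F = homSol lam i Z Y := by
  rw [proj_lie_eq_iff_eq_divLam hthr hZ hF hY, homSol]
  constructor <;> intro hE
  · have hT : transport lam i Z F = transport lam i Z (divLam lam Y) := by
      rw [hE, transport_divLam_sub_transport hZ hY hF]
    rwa [hT] at hE
  · have hT : transport lam i Z F = transport lam i Z (divLam lam Y) := by
      rw [hE, transport_divLam_sub_transport hZ hY hY.divLam]
    rwa [hT]

end Homological

/-! ### The weighted norm -/

theorem one_le_jap (k : Idx) : 1 ≤ jap k := le_max_right _ _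

theorem jap_pos (k : Idx) : 0 < jap k := one_pos.trans_le (one_le_jap k)

/-- The weight `⟨k⟩ e^{s √⟨k⟩}` for which `|x|_s` is the `ℓ²` norm of the weighted sequence. -/
def normWeight (s : ℝ) (k : Idx) : ℝ≥0∞ := ENNReal.ofReal (jap k * Real.exp (s * √(jap k)))

/-- The weight `e^{σ √⟨k⟩}` comparing the norms `|·|_s` and `|·|_{s+σ}`. -/
def expWeight (σ : ℝ) (k : Idx) : ℝ≥0∞ := ENNReal.ofReal (Real.exp (σ * √(jap k)))

theorem normWeight_ne_zero (s : ℝ) (k : Idx) : normWeight s k ≠ 0 := by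
  rw [normWeight, ENNReal.ofReal_ne_zero_iff]
  exact mul_pos (jap_pos k) (Real.exp_pos _)

theorem normWeight_add (s σ : ℝ) (k : Idx) :
    normWeight (s + σ) k = normWeight s k * expWeight σ k := by
  rw [normWeight, normWeight, expWeight,
    ← ENNReal.ofReal_mul (mul_nonneg (jap_pos k).le (Real.exp_pos _).le), mul_assoc,
    ← Real.exp_add, add_mul]

theorem weightedNorm_eq (s : ℝ) (y : Idx → ℝ≥0∞) :
    weightedNorm s y = (∑' k, (normWeight s k * y k) ^ 2) ^ (1 / 2 : ℝ) := by
  have h (k : Idx) :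
      ENNReal.ofReal (jap k ^ 2 * Real.exp (2 * s * √(jap k))) = normWeight s k ^ 2 := by
    rw [normWeight, ← ENNReal.ofReal_pow (mul_nonneg (jap_pos k).le (Real.exp_pos _).le), mul_pow,
      ← Real.exp_nat_mul, Nat.cast_ofNat, mul_assoc 2]
  simp only [weightedNorm, h, mul_pow]

theorem sq_rpow_half (a : ℝ≥0∞) : (a ^ 2) ^ (1 / 2 : ℝ) = a := by
  rw [← ENNReal.rpow_natCast, ← ENNReal.rpow_mul]
  norm_num

theorem weightedNorm_mono (s : ℝ) {y z : Idx → ℝ≥0∞} (h : y ≤ z) :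
    weightedNorm s y ≤ weightedNorm s z := by
  unfold weightedNorm
  gcongr with k
  exact h k

theorem weightedNorm_smul (s : ℝ) (c : ℝ≥0∞) (y : Idx → ℝ≥0∞) :
    weightedNorm s (c • y) = c * weightedNorm s y := by
  have h (k : Idx) : (normWeight s k * (c • y) k) ^ 2 = c ^ 2 * (normWeight s k * y k) ^ 2 := by
    rw [Pi.smul_apply, smul_eq_mul, mul_left_comm, mul_pow]
  rw [weightedNorm_eq, weightedNorm_eq, tsum_congr h, ENNReal.tsum_mul_left,
    ENNReal.mul_rpow_of_nonneg _ _ one_half_pos.le, sq_rpow_half]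

theorem weightedNorm_add_le (s : ℝ) (y z : Idx → ℝ≥0∞) :
    weightedNorm s (y + z) ≤ weightedNorm s y + weightedNorm s z := by
  let _ : MeasurableSpace Idx := ⊤
  have : MeasurableSingletonClass Idx := ⟨fun _ => trivial⟩
  have h (y : Idx → ℝ≥0∞) : weightedNorm s y =
      (∫⁻ k, (normWeight s * y) k ^ (2 : ℝ) ∂MeasureTheory.Measure.count) ^ (1 / 2 : ℝ) := by
    rw [MeasureTheory.lintegral_count, weightedNorm_eq]
    simp only [Pi.mul_apply, ENNReal.rpow_ofNat]
  rw [h, h, h, mul_add]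
  exact ENNReal.lintegral_Lp_add_le measurable_from_top.aemeasurable
    measurable_from_top.aemeasurable one_le_two

theorem weightedNorm_expWeight_mul (s σ : ℝ) (y : Idx → ℝ≥0∞) :
    weightedNorm s (expWeight σ * y) = weightedNorm (s + σ) y := by
  simp only [weightedNorm_eq, normWeight_add, Pi.mul_apply, mul_assoc]

theorem ne_top_of_weightedNorm_ne_top {s : ℝ} {y : Idx → ℝ≥0∞} (h : weightedNorm s y ≠ ⊤)
    (k : Idx) : y k ≠ ⊤ := by
  have hle : normWeight s k * y k ≤ weightedNorm s y := by
    rw [weightedNorm_eq, ← sq_rpow_half (normWeight s k * y k)]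
    exact ENNReal.rpow_le_rpow (ENNReal.le_tsum k) one_half_pos.le
  intro hk
  rw [hk, ENNReal.mul_top (normWeight_ne_zero s k)] at hle
  exact h (top_le_iff.mp hle)

/-! ### Majorants of power series -/

/-- The monomial `y^q = ∏ y_i^{q_i}`. -/
def evalMonomial {ι M : Type*} [CommMonoid M] (y : ι → M) (q : ι →₀ ℕ) : M :=
  q.prod fun i n => y i ^ n

/-- The majorant `∑_q |f_q| y^q` of a power series at a point of the positive cone. -/
def seriesMajorant {ι R : Type*} [NormedCommRing R] (f : MvPowerSeries ι R) (y : ι → ℝ≥0∞) :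
    ℝ≥0∞ :=
  ∑' q, ‖coeff q f‖ₑ * evalMonomial y q

/-- The derivative `∑_k v_k ∂(y^q)/∂y_k` of a monomial in the direction `v`. -/
def evalMonomialDeriv {ι : Type*} (y v : ι → ℝ≥0∞) (q : ι →₀ ℕ) : ℝ≥0∞ :=
  ∑' k, v k * (q k * evalMonomial y (q - single k 1))

section Series

variable {ι M R : Type*} [CommMonoid M] [NormedCommRing R]

theorem evalMonomial_zero (y : ι → M) : evalMonomial y 0 = 1 :=
  Finsupp.prod_zero_index

theorem evalMonomial_add (y : ι → M) (p q : ι →₀ ℕ) :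
    evalMonomial y (p + q) = evalMonomial y p * evalMonomial y q :=
  Finsupp.prod_add_index' (fun _ => pow_zero _) fun _ _ _ => pow_add _ _ _

theorem evalMonomial_single (y : ι → M) (i : ι) : evalMonomial y (single i 1) = y i := by
  simp [evalMonomial]

theorem evalMonomial_mul (y z : ι → M) (q : ι →₀ ℕ) :
    evalMonomial (y * z) q = evalMonomial y q * evalMonomial z q := by
  simp [evalMonomial, mul_pow, Finsupp.prod_mul]

theorem evalMonomial_const (c : M) (q : ι →₀ ℕ) :
    evalMonomial (fun _ => c) q = c ^ q.degree := by
  rw [evalMonomial, Finsupp.prod, Finset.prod_pow_eq_pow_sum, Finsupp.degree_apply]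

theorem evalMonomial_smul (c : ℝ≥0∞) (y : ι → ℝ≥0∞) (q : ι →₀ ℕ) :
    evalMonomial (c • y) q = c ^ q.degree * evalMonomial y q := by
  rw [← evalMonomial_const c, ← evalMonomial_mul]
  rfl

theorem evalMonomialDeriv_add (y v : ι → ℝ≥0∞) (p q : ι →₀ ℕ) :
    evalMonomialDeriv y v (p + q) =
      evalMonomialDeriv y v p * evalMonomial y q + evalMonomial y p * evalMonomialDeriv y v q := by
  have h (p q : ι →₀ ℕ) (k : ι) : (p k : ℝ≥0∞) * evalMonomial y (p + q - single k 1) =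
      p k * evalMonomial y (p - single k 1) * evalMonomial y q := by
    by_cases hpk : p k = 0
    · simp [hpk]
    · have hk : single k 1 ≤ p := by simpa [Finsupp.single_le_iff, Nat.one_le_iff_ne_zero]
      rw [← tsub_add_eq_add_tsub hk, evalMonomial_add, mul_assoc]
  simp only [evalMonomialDeriv, ← ENNReal.tsum_mul_left, ← ENNReal.tsum_mul_right,
    ← ENNReal.tsum_add]
  refine tsum_congr fun k => ?_
  rw [Finsupp.add_apply, Nat.cast_add, add_mul, h p q, add_comm p q, h q p]
  ring

theorem evalMonomialDeriv_single (y v : ι → ℝ≥0∞) (i : ι) :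
    evalMonomialDeriv y v (single i 1) = v i := by
  rw [evalMonomialDeriv, tsum_eq_single i]
  · simp [evalMonomial_zero]
  · intro k hk
    simp [Finsupp.single_eq_of_ne hk]

theorem evalMonomial_add_evalMonomialDeriv_le (y v : ι → ℝ≥0∞) (q : ι →₀ ℕ) :
    evalMonomial y q + evalMonomialDeriv y v q ≤ evalMonomial (y + v) q := by
  induction hn : q.degree generalizing q with
  | zero =>
    rw [(Finsupp.degree_eq_zero_iff q).mp hn]
    simp [evalMonomial_zero, evalMonomialDeriv]
  | succ n ih =>
    obtain ⟨i, hi⟩ : ∃ i, q i ≠ 0 := by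
      by_contra! hc
      rw [Finsupp.ext (g := 0) hc, map_zero] at hn
      exact n.succ_ne_zero hn.symm
    rw [← Finsupp.sub_add_single_one_cancel hi] at hn ⊢
    generalize q - single i 1 = p at hn ⊢
    have hp := ih p (by simpa using hn)
    simp only [evalMonomialDeriv_add, evalMonomialDeriv_single, evalMonomial_add,
      evalMonomial_single, Pi.add_apply]
    calc evalMonomial y p * y i + (evalMonomialDeriv y v p * y i + evalMonomial y p * v i)
        = (evalMonomial y p + evalMonomialDeriv y v p) * y i + evalMonomial y p * v i := by ring
      _ ≤ evalMonomial (y + v) p * y i + evalMonomial (y + v) p * v i := by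
          gcongr
          exact le_self_add.trans hp
      _ = evalMonomial (y + v) p * (y i + v i) := (mul_add _ _ _).symm

theorem tsum_sum_antidiagonal {A : Type*} [AddMonoid A] [Finset.HasAntidiagonal A]
    (f : A → A → ℝ≥0∞) :
    ∑' q, ∑ a ∈ antidiagonal q, f a.1 a.2 = ∑' a, ∑' b, f a b := by
  rw [← ENNReal.tsum_prod, ← Finset.HasAntidiagonal.sigmaAntidiagonalEquivProd.tsum_eq,
    ENNReal.tsum_sigma']
  exact tsum_congr fun q =>
    (Finset.tsum_subtype (antidiagonal q) fun a : A × A => f a.1 a.2).symm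

theorem enorm_mul_le {A : Type*} [NonUnitalSeminormedRing A] (a b : A) :
    ‖a * b‖ₑ ≤ ‖a‖ₑ * ‖b‖ₑ := by
  simpa only [enorm_eq_nnnorm, ← ENNReal.coe_mul, ENNReal.coe_le_coe] using nnnorm_mul_le a b

theorem seriesMajorant_mul_le (f g : MvPowerSeries ι R) (y : ι → ℝ≥0∞) :
    seriesMajorant (f * g) y ≤ seriesMajorant f y * seriesMajorant g y := by
  classical
  calc seriesMajorant (f * g) y
      ≤ ∑' q, ∑ a ∈ antidiagonal q, ‖coeff a.1 f‖ₑ * evalMonomial y a.1 *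
          (‖coeff a.2 g‖ₑ * evalMonomial y a.2) := by
        refine ENNReal.tsum_le_tsum fun q => ?_
        rw [MvPowerSeries.coeff_mul]
        refine (mul_le_mul_left (enorm_sum_le _ _) _).trans ?_
        rw [Finset.sum_mul]
        refine Finset.sum_le_sum fun a ha => ?_
        rw [← mem_antidiagonal.mp ha, evalMonomial_add, mul_mul_mul_comm]
        gcongr
        exact enorm_mul_le _ _
    _ = seriesMajorant f y * seriesMajorant g y := by
        rw [tsum_sum_antidiagonal fun a b => ‖coeff a f‖ₑ * evalMonomial y a *
          (‖coeff b g‖ₑ * evalMonomial y b)]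
        simp only [ENNReal.tsum_mul_left, ENNReal.tsum_mul_right, seriesMajorant]

theorem seriesMajorant_pderiv_le [NormOneClass R] (f : MvPowerSeries ι R) (k : ι)
    (y : ι → ℝ≥0∞) :
    seriesMajorant (pderiv R k f) y ≤
      ∑' q, ‖coeff q f‖ₑ * (q k * evalMonomial y (q - single k 1)) := by
  refine le_trans (ENNReal.tsum_le_tsum fun q => ?_)
    (ENNReal.tsum_comp_le_tsum_of_injective (add_left_injective (single k 1)) _)
  have hcast : ‖((q k : R) + 1)‖ₑ ≤ ((q k + 1 : ℕ) : ℝ≥0∞) := by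
    rw [← Nat.cast_add_one, ← ofReal_norm, ← ENNReal.ofReal_natCast]
    exact ENNReal.ofReal_le_ofReal (by simpa using Nat.norm_cast_le (α := R) (q k + 1))
  simp only [MvPowerSeries.coeff_pderiv, add_tsub_cancel_right, Finsupp.add_apply,
    Finsupp.single_eq_same]
  rw [← mul_assoc]
  gcongr
  exact (enorm_mul_le _ _).trans (mul_le_mul_right hcast _)

end Series

/-! ### Majorant norms of vector fields -/

/-- The majorant `(∑_q |V_q^{(k)}| y^q)_k` of a vector field at a point of the positive cone. -/
def majorant (V : FormalVF) (y : Idx → ℝ≥0∞) : Idx → ℝ≥0∞ := fun k => seriesMajorant (V k) y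

section Majorant

variable {s r r' : ℝ} {V W X Z : FormalVF}

theorem weightedNorm_majorant_le (hr : 0 < r) (V : FormalVF) {y : Idx → ℝ≥0∞}
    (hy : weightedNorm s y < ENNReal.ofReal r) :
    weightedNorm s (majorant V y) ≤ ENNReal.ofReal r * majNorm s r V := by
  let x : Idx → ℂ := fun k => ((y k).toReal : ℂ)
  have hx (k : Idx) : ‖x k‖ₑ = y k := by
    rw [← ofReal_norm, Complex.norm_real, Real.norm_of_nonneg ENNReal.toReal_nonneg,
      ENNReal.ofReal_toReal (ne_top_of_weightedNorm_ne_top hy.ne_top k)]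
  have hxr : gNorm s x < ENNReal.ofReal r := by simpa only [gNorm, hx] using hy
  have hle := le_iSup₂ (f := fun (x : Idx → ℂ) (_ : gNorm s x < ENNReal.ofReal r) =>
    weightedNorm s fun k => ∑' q : Idx →₀ ℕ, ‖cf V k q‖ₑ * q.prod fun i n => ‖x i‖ₑ ^ n) x hxr
  simp only [hx] at hle
  rw [majNorm, ← mul_assoc, ← ENNReal.ofReal_mul hr.le, mul_inv_cancel₀ hr.ne', ENNReal.ofReal_one,
    one_mul]
  exact hle

theorem majNorm_le (hr : 0 < r) {B : ℝ≥0∞}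
    (h : ∀ y : Idx → ℝ≥0∞, weightedNorm s y < ENNReal.ofReal r →
      weightedNorm s (majorant V y) ≤ ENNReal.ofReal r * B) : majNorm s r V ≤ B :=
  calc majNorm s r V ≤ ENNReal.ofReal r⁻¹ * (ENNReal.ofReal r * B) := by
        unfold majNorm
        gcongr
        exact iSup₂_le fun x hx => h _ hx
    _ = B := by
        rw [← mul_assoc, ← ENNReal.ofReal_mul (inv_pos.mpr hr).le, inv_mul_cancel₀ hr.ne',
          ENNReal.ofReal_one, one_mul]

theorem majNorm_mono (hr : 0 < r) (h : ∀ k q, ‖cf V k q‖ₑ ≤ ‖cf W k q‖ₑ) :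
    majNorm s r V ≤ majNorm s r W :=
  majNorm_le hr fun _ hy =>
    (weightedNorm_mono s fun k => ENNReal.tsum_le_tsum fun q => mul_le_mul_left (h k q) _).trans
      (weightedNorm_majorant_le hr W hy)

theorem majNorm_sub_le (hr : 0 < r) (V W : FormalVF) :
    majNorm s r (V - W) ≤ majNorm s r V + majNorm s r W := by
  refine majNorm_le hr fun y hy => ?_
  have hle : majorant (V - W) y ≤ majorant V y + majorant W y := by
    intro k
    simp only [majorant, seriesMajorant, Pi.add_apply, Pi.sub_apply, map_sub, ← ENNReal.tsum_add,
      ← add_mul]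
    gcongr with q
    exact enorm_sub_le
  calc weightedNorm s (majorant (V - W) y)
      ≤ weightedNorm s (majorant V y) + weightedNorm s (majorant W y) :=
        (weightedNorm_mono s hle).trans (weightedNorm_add_le s _ _)
    _ ≤ ENNReal.ofReal r * majNorm s r V + ENNReal.ofReal r * majNorm s r W :=
        add_le_add (weightedNorm_majorant_le hr V hy) (weightedNorm_majorant_le hr W hy)
    _ = ENNReal.ofReal r * (majNorm s r V + majNorm s r W) := (mul_add _ _ _).symm

theorem majorant_smul_le (h0 : ∀ k, cf V k 0 = 0) {c : ℝ≥0∞} (hc : c ≤ 1) (y : Idx → ℝ≥0∞) :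
    majorant V (c • y) ≤ c • majorant V y := by
  intro k
  rw [Pi.smul_apply, smul_eq_mul, majorant, seriesMajorant, majorant, seriesMajorant,
    ← ENNReal.tsum_mul_left]
  refine ENNReal.tsum_le_tsum fun q => ?_
  by_cases hq : q = 0
  · rw [hq, show coeff 0 (V k) = 0 from h0 k, enorm_zero, zero_mul]
    exact zero_le
  · rw [evalMonomial_smul, mul_left_comm]
    gcongr
    exact pow_le_of_le_one zero_le hc (degree_pos_of_ne_zero hq).ne'

theorem majNorm_le_of_radius_le (hr' : 0 < r') (hrr : r' ≤ r) (h0 : ∀ k, cf V k 0 = 0) :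
    majNorm s r' V ≤ majNorm s r V := by
  have hr : 0 < r := hr'.trans_le hrr
  refine majNorm_le hr' fun y hy => ?_
  have hy_eq : y = ENNReal.ofReal (r' / r) • ENNReal.ofReal (r / r') • y := by
    rw [smul_smul, ← ENNReal.ofReal_mul (by positivity), div_mul_div_cancel₀ hr.ne',
      div_self hr'.ne', ENNReal.ofReal_one, one_smul]
  have hyr : weightedNorm s (ENNReal.ofReal (r / r') • y) < ENNReal.ofReal r := by
    rw [weightedNorm_smul, ← div_mul_cancel₀ r hr'.ne', ENNReal.ofReal_mul (by positivity),
      div_mul_cancel₀ r hr'.ne']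
    exact ENNReal.mul_lt_mul_right (ENNReal.ofReal_ne_zero_iff.mpr (by positivity))
      ENNReal.ofReal_ne_top hy
  calc weightedNorm s (majorant V y)
      ≤ ENNReal.ofReal (r' / r) * weightedNorm s (majorant V (ENNReal.ofReal (r / r') • y)) := by
        conv_lhs => rw [hy_eq]
        rw [← weightedNorm_smul]
        refine weightedNorm_mono s (majorant_smul_le h0 ?_ _)
        exact ENNReal.ofReal_le_one.mpr ((div_le_one hr).mpr hrr)
    _ ≤ ENNReal.ofReal (r' / r) * (ENNReal.ofReal r * majNorm s r V) := by
        gcongr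
        exact weightedNorm_majorant_le hr V hyr
    _ = ENNReal.ofReal r' * majNorm s r V := by
        rw [← mul_assoc, ← ENNReal.ofReal_mul (by positivity), div_mul_cancel₀ _ hr.ne']

theorem majNorm_add_le_of_coeff_le {σ : ℝ} (hr : 0 < r) {B : ℝ≥0∞}
    (h : ∀ k q, expWeight σ k * ‖cf W k q‖ₑ ≤ B * (evalMonomial (expWeight σ) q * ‖cf V k q‖ₑ)) :
    majNorm (s + σ) r W ≤ B * majNorm s r V := by
  refine majNorm_le hr fun y hy => ?_
  rw [← weightedNorm_expWeight_mul] at hy ⊢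
  have hle : expWeight σ * majorant W y ≤ B • majorant V (expWeight σ * y) := by
    intro k
    simp only [Pi.mul_apply, Pi.smul_apply, smul_eq_mul, majorant, seriesMajorant,
      ← ENNReal.tsum_mul_left]
    refine ENNReal.tsum_le_tsum fun q => ?_
    rw [evalMonomial_mul, ← mul_assoc]
    exact (mul_le_mul_left (h k q) _).trans_eq (by rw [cf]; ring)
  calc weightedNorm s (expWeight σ * majorant W y)
      ≤ B * weightedNorm s (majorant V (expWeight σ * y)) :=
        (weightedNorm_mono s hle).trans_eq (weightedNorm_smul s B _)
    _ ≤ B * (ENNReal.ofReal r * majNorm s r V) := by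
        gcongr
        exact weightedNorm_majorant_le hr V hy
    _ = ENNReal.ofReal r * (B * majNorm s r V) := mul_left_comm _ _ _

/-! ### The Cauchy estimate -/

theorem majorant_applyField_le (X Z : FormalVF) (y : Idx → ℝ≥0∞) (j : Idx) :
    majorant (applyField X Z) y j ≤
      ∑' q, ‖cf Z j q‖ₑ * evalMonomialDeriv y (majorant X y) q :=
  calc majorant (applyField X Z) y j
      ≤ ∑' q, ∑' k, ‖coeff q (X k * pderiv ℂ k (Z j))‖ₑ * evalMonomial y q := by
        simp only [ENNReal.tsum_mul_right]
        exact ENNReal.tsum_le_tsum fun q => mul_le_mul_left enorm_tsum_le_tsum_enorm _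
    _ = ∑' k, seriesMajorant (X k * pderiv ℂ k (Z j)) y := ENNReal.tsum_comm
    _ ≤ ∑' k, majorant X y k *
          ∑' q, ‖cf Z j q‖ₑ * (q k * evalMonomial y (q - single k 1)) := by
        gcongr with k
        exact (seriesMajorant_mul_le _ _ y).trans
          (mul_le_mul_right (seriesMajorant_pderiv_le _ _ _) _)
    _ = ∑' q, ‖cf Z j q‖ₑ * evalMonomialDeriv y (majorant X y) q := by
        simp only [evalMonomialDeriv, ← ENNReal.tsum_mul_left, mul_left_comm (majorant X y _)]
        exact ENNReal.tsum_comm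

theorem smul_majorant_applyField_le (X Z : FormalVF) (y : Idx → ℝ≥0∞) (t : ℝ≥0∞) :
    t • majorant (applyField X Z) y ≤ majorant Z (y + t • majorant X y) := by
  intro j
  have hsmul (q : Idx →₀ ℕ) : t * evalMonomialDeriv y (majorant X y) q =
      evalMonomialDeriv y (t • majorant X y) q := by
    simp only [evalMonomialDeriv, ← ENNReal.tsum_mul_left, Pi.smul_apply, smul_eq_mul, mul_assoc]
  refine (mul_le_mul_right (majorant_applyField_le X Z y j) t).trans ?_
  rw [← ENNReal.tsum_mul_left]
  refine ENNReal.tsum_le_tsum fun q => ?_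
  rw [mul_left_comm, hsmul]
  exact mul_le_mul_right (le_add_self.trans (evalMonomial_add_evalMonomialDeriv_le _ _ q)) _

theorem majNorm_applyField_le {ρ : ℝ} (hρ : 0 < ρ) (hρr : ρ < r) (hX : majNorm s (r - ρ) X < ⊤)
    (hZ : majNorm s r Z < ⊤) :
    majNorm s (r - ρ) (applyField X Z) ≤
      ENNReal.ofReal (r / ρ) * (majNorm s (r - ρ) X * majNorm s r Z) := by
  have hr : 0 < r := hρ.trans hρr
  have hr' : 0 < r - ρ := sub_pos.mpr hρr
  refine majNorm_le hr' fun y hy => ?_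
  set N := ENNReal.ofReal (r - ρ) * majNorm s (r - ρ) X with hN
  have hN_top : N ≠ ⊤ := ENNReal.mul_ne_top ENNReal.ofReal_ne_top hX.ne
  have hρ0 : ENNReal.ofReal ρ ≠ 0 := ENNReal.ofReal_ne_zero_iff.mpr hρ
  -- the largest multiple `t` of `X` which moves `y` by at most `ρ`
  set t := ENNReal.ofReal ρ / N with ht
  have ht0 : t ≠ 0 := ENNReal.div_ne_zero.mpr ⟨hρ0, hN_top⟩
  have htX : weightedNorm s (t • majorant X y) ≤ ENNReal.ofReal ρ := by
    rw [weightedNorm_smul]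
    exact (mul_le_mul_right (weightedNorm_majorant_le hr' X hy) t).trans
      ((mul_comm t N).trans_le ENNReal.mul_div_le)
  have hyX : weightedNorm s (y + t • majorant X y) < ENNReal.ofReal r := by
    rw [← sub_add_cancel r ρ, ENNReal.ofReal_add hr'.le hρ.le]
    exact (weightedNorm_add_le s _ _).trans_lt (ENNReal.add_lt_add_of_lt_of_le
      (ne_top_of_le_ne_top ENNReal.ofReal_ne_top htX) hy htX)
  have htXZ : weightedNorm s (majorant (applyField X Z) y) * t ≤
      ENNReal.ofReal r * majNorm s r Z := by
    rw [mul_comm, ← weightedNorm_smul]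
    exact (weightedNorm_mono s (smul_majorant_applyField_le X Z y t)).trans
      (weightedNorm_majorant_le hr Z hyX)
  calc weightedNorm s (majorant (applyField X Z) y)
      ≤ ENNReal.ofReal r * majNorm s r Z / t :=
        (ENNReal.le_div_iff_mul_le (.inl ht0)
          (.inr (ENNReal.mul_ne_top ENNReal.ofReal_ne_top hZ.ne))).mpr htXZ
    _ = ENNReal.ofReal (r - ρ) *
          (ENNReal.ofReal (r / ρ) * (majNorm s (r - ρ) X * majNorm s r Z)) := by
        rw [ht, div_eq_mul_inv, ENNReal.inv_div (.inl hN_top) (.inr hρ0),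
          ENNReal.ofReal_div_of_pos hρ, hN, div_eq_mul_inv, div_eq_mul_inv]
        ring

end Majorant

/-! ### Weights of exponents -/

section LinearCombination

variable {ι : Type*} {q : ι →₀ ℕ}

theorem linearCombination_nat_mono {v w : ι → ℝ} (h : ∀ i ∈ q.support, v i ≤ w i) :
    linearCombination ℕ v q ≤ linearCombination ℕ w q :=
  Finset.sum_le_sum fun i hi => nsmul_le_nsmul_right (h i hi) (q i)

theorem linearCombination_nat_mul_const (v : ι → ℝ) (c : ℝ) :
    linearCombination ℕ (fun i => v i * c) q = linearCombination ℕ v q * c := by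
  simp only [Finsupp.linearCombination_apply, Finsupp.sum, Finset.sum_mul, smul_mul_assoc]

theorem norm_linearCombination_nat_le {E : Type*} [NormedAddCommGroup E] {v : ι → E} {w : ι → ℝ}
    (h : ∀ i, ‖v i‖ ≤ w i) : ‖linearCombination ℕ v q‖ ≤ linearCombination ℕ w q := by
  refine (norm_sum_le _ _).trans (Finset.sum_le_sum fun i _ => ?_)
  calc ‖q i • v i‖ ≤ q i * ‖v i‖ := norm_nsmul_le
    _ ≤ q i * w i := by
        gcongr
        exact h i
    _ = q i • w i := (nsmul_eq_mul _ _).symm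

end LinearCombination

/-- The weight `∑_i q_i √⟨i⟩` of an exponent, so that `x^q` picks up the factor `e^{σ w(q)}`, with
`w(q)` this weight, when every `x_i` is multiplied by `e^{σ √⟨i⟩}`. -/
def sqrtWeight (q : Idx →₀ ℕ) : ℝ := linearCombination ℕ (fun i => √(jap i)) q

theorem sqrtWeight_add (p q : Idx →₀ ℕ) : sqrtWeight (p + q) = sqrtWeight p + sqrtWeight q :=
  map_add _ p q

theorem sqrtWeight_single (a : Idx) : sqrtWeight (single a 1) = √(jap a) := by
  rw [sqrtWeight, Finsupp.linearCombination_single, one_smul]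

theorem sqrtWeight_nonneg (q : Idx →₀ ℕ) : 0 ≤ sqrtWeight q :=
  Finset.sum_nonneg fun i _ => nsmul_nonneg (Real.sqrt_nonneg _) (q i)

theorem evalMonomial_expWeight (σ : ℝ) (q : Idx →₀ ℕ) :
    evalMonomial (expWeight σ) q = ENNReal.ofReal (Real.exp (σ * sqrtWeight q)) := by
  rw [sqrtWeight, Finsupp.linearCombination_apply, Finsupp.sum, Finset.mul_sum, Real.exp_sum,
    ENNReal.ofReal_prod_of_nonneg fun _ _ => (Real.exp_pos _).le]
  refine Finset.prod_congr rfl fun i _ => ?_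
  change ENNReal.ofReal _ ^ q i = ENNReal.ofReal (Real.exp (σ * q i • √(jap i)))
  rw [← ENNReal.ofReal_pow (Real.exp_pos _).le, ← Real.exp_nat_mul, nsmul_eq_mul,
    mul_left_comm]

theorem sqrt_jap_le_sqrtWeight {q : Idx →₀ ℕ} {i : Idx} (hi : i ∈ q.support) :
    √(jap i) ≤ sqrtWeight q :=
  calc √(jap i) ≤ q i • √(jap i) :=
        le_self_nsmul (Real.sqrt_nonneg _) (Finsupp.mem_support_iff.mp hi)
    _ ≤ sqrtWeight q :=
        Finset.single_le_sum (f := fun i => q i • √(jap i))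
          (fun i _ => nsmul_nonneg (Real.sqrt_nonneg _) (q i)) hi

theorem one_le_sqrtWeight {q : Idx →₀ ℕ} (hq : q ≠ 0) : 1 ≤ sqrtWeight q := by
  obtain ⟨i, hi⟩ := Finsupp.support_nonempty_iff.mpr hq
  exact (Real.one_le_sqrt.mpr (one_le_jap i)).trans (sqrt_jap_le_sqrtWeight hi)

theorem linearCombination_jap_pow_le (q : Idx →₀ ℕ) (m : ℕ) :
    linearCombination ℕ (fun i => jap i ^ (m + 1)) q ≤ sqrtWeight q ^ (2 * (m + 1)) := by
  have h (i : Idx) (hi : i ∈ q.support) :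
      jap i ^ (m + 1) ≤ √(jap i) * sqrtWeight q ^ (2 * m + 1) :=
    calc jap i ^ (m + 1) = √(jap i) * √(jap i) ^ (2 * m + 1) := by
          rw [← pow_succ', add_assoc, one_add_one_eq_two, ← mul_add_one, pow_mul,
            Real.sq_sqrt (jap_pos i).le]
      _ ≤ _ := by
          gcongr
          exact sqrt_jap_le_sqrtWeight hi
  refine (linearCombination_nat_mono h).trans_eq ?_
  rw [linearCombination_nat_mul_const, ← sqrtWeight, ← pow_succ']
  rfl

theorem norm_mom (k : Idx) : ‖mom k‖ = |(k.1 : ℝ)| := by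
  rw [mom, norm_mul, Int.norm_eq_abs, Int.norm_eq_abs]
  rcases Int.units_eq_one_or k.2 with h | h <;> simp [h]

theorem jap_eq_max_norm_mom (k : Idx) : jap k = max ‖mom k‖ 1 := by rw [jap, norm_mom]

theorem norm_mom_le_jap (k : Idx) : ‖mom k‖ ≤ jap k :=
  (le_max_left _ _).trans_eq (jap_eq_max_norm_mom k).symm

theorem jap_le_add_of_mom_eq {p : Idx →₀ ℕ} {a k : Idx}
    (hmom : linearCombination ℕ mom (p + single a 1) = mom k) :
    jap k ≤ jap a + linearCombination ℕ jap p := by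
  have hB : 0 ≤ linearCombination ℕ jap p :=
    Finset.sum_nonneg fun i _ => nsmul_nonneg (jap_pos i).le (p i)
  rw [jap_eq_max_norm_mom k, ← hmom, map_add, Finsupp.linearCombination_single, one_smul, add_comm]
  refine max_le ((norm_add_le _ _).trans ?_) (by linarith [one_le_jap a])
  exact add_le_add (norm_mom_le_jap a) (norm_linearCombination_nat_le norm_mom_le_jap)

theorem exists_eq_add_single_max {q : Idx →₀ ℕ} (hq : q ≠ 0) :
    ∃ a p, q = p + single a 1 ∧ ∀ i ∈ p.support, jap i ≤ jap a := by
  obtain ⟨a, ha, hmax⟩ := Finset.exists_max_image q.support jap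
    (Finsupp.support_nonempty_iff.mpr hq)
  have hle : single a 1 ≤ q :=
    Finsupp.single_le_iff.mpr (Nat.one_le_iff_ne_zero.mpr (Finsupp.mem_support_iff.mp ha))
  exact ⟨a, q - single a 1, (tsub_add_cancel_of_le hle).symm,
    fun i hi => hmax i (Finsupp.support_mono tsub_le_self hi)⟩

/-- With `S = ∑_i p_i ⟨i⟩` and `w` the weight, `⟨k⟩ ≤ ⟨a⟩ + S ≤ ⟨a⟩ + √⟨a⟩ w(p)` by momentum
conservation and the maximality of `⟨a⟩`, and the right side is at most `(√⟨a⟩ + w(p) / 2)²`. -/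
theorem half_sqrtWeight_le {p : Idx →₀ ℕ} {a k : Idx} (ha : ∀ i ∈ p.support, jap i ≤ jap a)
    (hmom : linearCombination ℕ mom (p + single a 1) = mom k) :
    sqrtWeight p / 2 ≤ sqrtWeight (p + single a 1) - √(jap k) := by
  have hs : 0 ≤ √(jap a) := Real.sqrt_nonneg _
  have hS : linearCombination ℕ jap p ≤ sqrtWeight p * √(jap a) := by
    rw [sqrtWeight, ← linearCombination_nat_mul_const]
    refine linearCombination_nat_mono fun i hi => ?_
    calc jap i = √(jap i) * √(jap i) := (Real.mul_self_sqrt (jap_pos i).le).symm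
      _ ≤ √(jap i) * √(jap a) := by
        gcongr
        exact ha i hi
  have hk : √(jap k) ≤ √(jap a) + sqrtWeight p / 2 := by
    refine Real.sqrt_le_iff.mpr ⟨by linarith [sqrtWeight_nonneg p], ?_⟩
    nlinarith [jap_le_add_of_mom_eq hmom, Real.sq_sqrt (jap_pos a).le, sq_nonneg (sqrtWeight p)]
  rw [sqrtWeight_add, sqrtWeight_single]
  linarith

theorem sqrt_jap_le_sqrtWeight_of_mom_eq {q : Idx →₀ ℕ} {k : Idx} (hq : q ≠ 0)
    (hmom : linearCombination ℕ mom q = mom k) : √(jap k) ≤ sqrtWeight q := by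
  obtain ⟨a, p, rfl, ha⟩ := exists_eq_add_single_max hq
  linarith [half_sqrtWeight_le ha hmom, sqrtWeight_nonneg p]

/-! ### Absorbing polynomial factors -/

/-- The constant in front of `σ⁻⁶ t⁻⁴` in `mul_log_one_add_pow_four_le`. -/
def logConst (θ : ℝ) : ℝ := 14 * θ * (56 * θ) ^ 6

theorem logConst_pos {θ : ℝ} (hθ : 0 < θ) : 0 < logConst θ := by
  unfold logConst
  positivity

/-- The powers come from `t^{2/7} = (σ t)^{6/7} (σ⁻⁶ t⁻⁴)^{1/7}`: some power of `t` lies between the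
two terms on the right, whatever `σ` is. With `t = w⁷` it is `w²`. -/
theorem mul_log_one_add_pow_four_le {θ σ t : ℝ} (hθ : 0 < θ) (hσ : 0 < σ) (ht : 0 < t) :
    θ * Real.log (1 + t ^ 4) ≤ σ / 4 * t + logConst θ / σ ^ 6 * (t ^ 4)⁻¹ := by
  obtain ⟨w, hw, rfl⟩ : ∃ w : ℝ, 0 < w ∧ w ^ 7 = t :=
    ⟨t ^ ((7 : ℕ) : ℝ)⁻¹, Real.rpow_pos_of_pos ht _,
      Real.rpow_inv_natCast_pow ht.le (by norm_num)⟩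
  have hL := logConst_pos hθ
  have hlog : Real.log (1 + (w ^ 7) ^ 4) ≤ 14 * w ^ 2 :=
    calc Real.log (1 + (w ^ 7) ^ 4) = Real.log (1 ^ 14 + (w ^ 2) ^ 14) := by
          rw [one_pow, ← pow_mul, ← pow_mul]
      _ ≤ Real.log ((1 + w ^ 2) ^ 14) :=
          Real.log_le_log (by positivity)
            (pow_add_pow_le zero_le_one (sq_nonneg w) (by norm_num))
      _ = 14 * Real.log (1 + w ^ 2) := by
          rw [Real.log_pow]
          norm_num
      _ ≤ 14 * w ^ 2 := by
          have := Real.log_le_sub_one_of_pos (show 0 < 1 + w ^ 2 by positivity)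
          linarith
  have hmul : θ * Real.log (1 + (w ^ 7) ^ 4) ≤ 14 * θ * w ^ 2 := by
    linarith [mul_le_mul_of_nonneg_left hlog hθ.le]
  rcases le_total (56 * θ) (σ * w ^ 5) with hlarge | hsmall
  · have hfst : 14 * θ * w ^ 2 ≤ σ / 4 * w ^ 7 :=
      calc 14 * θ * w ^ 2 = 56 * θ * w ^ 2 / 4 := by ring
        _ ≤ σ * w ^ 5 * w ^ 2 / 4 := by gcongr
        _ = σ / 4 * w ^ 7 := by ring
    exact (hmul.trans hfst).trans (le_add_of_nonneg_right (by positivity))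
  · have hsnd : 14 * θ * w ^ 2 ≤ logConst θ / σ ^ 6 * ((w ^ 7) ^ 4)⁻¹ := by
      rw [← div_eq_mul_inv, div_div, le_div_iff₀ (by positivity), logConst]
      calc 14 * θ * w ^ 2 * (σ ^ 6 * (w ^ 7) ^ 4) = 14 * θ * (σ * w ^ 5) ^ 6 := by ring
        _ ≤ 14 * θ * (56 * θ) ^ 6 := by gcongr
    exact (hmul.trans hsnd).trans (le_add_of_nonneg_left (by positivity))

theorem mul_log_one_add_sq_mul_sq_le {θ σ n j : ℝ} (hθ : 0 < θ) (hσ : 0 < σ) (hn : 1 ≤ n)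
    (hj : 0 < j) :
    θ * Real.log (1 + n ^ 2 * j ^ 2) ≤ σ / 4 * (n * √j) + logConst θ / σ ^ 6 * (j ^ 2)⁻¹ := by
  have hL := logConst_pos hθ
  have hpow : (n * √j) ^ 4 = n ^ 4 * j ^ 2 := by
    rw [mul_pow, show √j ^ 4 = (√j ^ 2) ^ 2 by ring, Real.sq_sqrt hj.le]
  calc θ * Real.log (1 + n ^ 2 * j ^ 2) ≤ θ * Real.log (1 + (n * √j) ^ 4) := by
        rw [hpow]
        gcongr 4
        exact pow_le_pow_right₀ hn (by norm_num)
    _ ≤ σ / 4 * (n * √j) + logConst θ / σ ^ 6 * ((n * √j) ^ 4)⁻¹ :=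
        mul_log_one_add_pow_four_le hθ hσ (by positivity)
    _ ≤ σ / 4 * (n * √j) + logConst θ / σ ^ 6 * (j ^ 2)⁻¹ := by
        rw [hpow]
        gcongr
        exact le_mul_of_one_le_left (sq_nonneg j) (one_le_pow₀ hn)

theorem rpow_one_add_sqrtWeight_pow_le {θ σ : ℝ} (hθ : 0 < θ) (hσ : 0 < σ) (q : Idx →₀ ℕ) :
    (1 + sqrtWeight q ^ 4) ^ θ ≤ Real.exp (σ / 4 * sqrtWeight q + logConst θ / σ ^ 6) := by
  have hL := logConst_pos hθ
  rcases eq_or_ne q 0 with rfl | hq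
  · have h0 : sqrtWeight 0 = 0 := map_zero _
    rw [h0, zero_pow four_ne_zero, add_zero, Real.one_rpow]
    exact Real.one_le_exp (by positivity)
  · have hT := one_le_sqrtWeight hq
    rw [Real.rpow_def_of_pos (by positivity), mul_comm]
    refine Real.exp_le_exp.mpr ((mul_log_one_add_pow_four_le hθ hσ (by positivity)).trans ?_)
    gcongr
    exact mul_le_of_le_one_right (by positivity) (inv_le_one_of_one_le₀ (one_le_pow₀ hT))

/-- The product `∏_i (1 + p_i² ⟨i⟩²)` of the Diophantine condition. -/
def japProd (p : Idx →₀ ℤ) : ℝ := p.prod fun i n => 1 + (n : ℝ) ^ 2 * jap i ^ 2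

theorem one_le_japProd (p : Idx →₀ ℤ) : 1 ≤ japProd p :=
  Finset.one_le_prod fun _ _ => le_add_of_nonneg_right (by positivity)

theorem japProd_pos (p : Idx →₀ ℤ) : 0 < japProd p := one_pos.trans_le (one_le_japProd p)

theorem japProd_add_single_le (p : Idx →₀ ℤ) (i : Idx) {e : ℤ} (he : e ^ 2 = 1) :
    japProd (p + single i e) ≤ 4 * jap i ^ 2 * japProd p := by
  have hfactor : 1 + ((p i + e : ℤ) : ℝ) ^ 2 * jap i ^ 2 ≤
      4 * jap i ^ 2 * (1 + (p i : ℝ) ^ 2 * jap i ^ 2) := by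
    have hj : 1 ≤ jap i ^ 2 := one_le_pow₀ (one_le_jap i)
    have he' : (e : ℝ) ^ 2 = 1 := by exact_mod_cast he
    have hsq : ((p i + e : ℤ) : ℝ) ^ 2 ≤ 2 * (p i : ℝ) ^ 2 + 2 := by
      push_cast
      linarith [add_sq_le (a := (p i : ℝ)) (b := e)]
    nlinarith [mul_le_mul_of_nonneg_right hsq (sq_nonneg (jap i)),
      mul_nonneg (mul_nonneg (sq_nonneg (p i : ℝ)) (sq_nonneg (jap i))) (sub_nonneg.mpr hj)]
  rw [japProd, japProd, ← Finsupp.mul_prod_erase' (p + single i e) i _ (by simp),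
    ← Finsupp.mul_prod_erase' p i _ (by simp), Finsupp.erase_add, Finsupp.erase_single, add_zero,
    Finsupp.add_apply, Finsupp.single_eq_same, ← mul_assoc]
  exact mul_le_mul_of_nonneg_right hfactor (japProd_pos _).le

theorem summable_inv_jap_sq : Summable fun k : Idx => (jap k ^ 2)⁻¹ := by
  have hInt : Summable fun n : ℤ => ((max |(n : ℝ)| 1) ^ 2)⁻¹ := by
    refine Summable.of_nonneg_of_le (fun n => by positivity) (fun n => ?_)
      ((Real.summable_one_div_int_pow (p := 2).mpr one_lt_two).add
        (hasSum_ite_eq (0 : ℤ) (1 : ℝ)).summable)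
    rcases eq_or_ne n 0 with rfl | hn
    · simp
    · rw [max_eq_left (by exact_mod_cast Int.one_le_abs hn), sq_abs]
      simp [hn]
  simpa [jap] using hInt.mul_of_nonneg (Summable.of_finite (f := fun _ : ℤˣ => (1 : ℝ)))
    (fun n => by positivity) fun _ => zero_le_one

theorem japProd_rpow_le {θ σ : ℝ} (hθ : 0 < θ) (hσ : 0 < σ) (q : Idx →₀ ℕ) :
    japProd (toInt q) ^ θ ≤
      Real.exp (σ / 4 * sqrtWeight q + logConst θ * (∑' k, (jap k ^ 2)⁻¹) / σ ^ 6) := by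
  have hL := logConst_pos hθ
  have hprod : japProd (toInt q) = ∏ i ∈ q.support, (1 + (q i : ℝ) ^ 2 * jap i ^ 2) := by
    rw [japProd, toInt, Finsupp.prod_mapRange_index (by simp)]
    simp only [Int.cast_natCast, Finsupp.prod]
  have hlog (i : Idx) (hi : i ∈ q.support) : θ * Real.log (1 + (q i : ℝ) ^ 2 * jap i ^ 2) ≤
      σ / 4 * (q i • √(jap i)) + logConst θ / σ ^ 6 * (jap i ^ 2)⁻¹ := by
    rw [nsmul_eq_mul]
    refine mul_log_one_add_sq_mul_sq_le hθ hσ ?_ (jap_pos i)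
    exact_mod_cast Nat.one_le_iff_ne_zero.mpr (Finsupp.mem_support_iff.mp hi)
  rw [Real.rpow_def_of_pos (japProd_pos _), hprod, Real.log_prod fun i _ => by positivity, mul_comm,
    Finset.mul_sum]
  refine Real.exp_le_exp.mpr ((Finset.sum_le_sum hlog).trans ?_)
  rw [Finset.sum_add_distrib, ← Finset.mul_sum, ← Finset.mul_sum, mul_div_right_comm]
  refine add_le_add le_rfl (mul_le_mul_of_nonneg_left ?_ (by positivity))
  exact summable_inv_jap_sq.sum_le_tsum _ fun i _ => by positivity

/-! ### Small divisors -/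

theorem linearCombination_toInt_sub_single {E : Type*} [AddCommGroup E] (v : Idx → E)
    (q : Idx →₀ ℕ) (k : Idx) :
    linearCombination ℤ v (toInt q - single k 1) = linearCombination ℕ v q - v k := by
  rw [map_sub, linearCombination_toInt, Finsupp.linearCombination_single, one_smul]

section SmallDivisors

variable {C γ τ θ : ℝ} {a k : Idx} {p q : Idx →₀ ℕ}

theorem DiophantineMod.inv_norm_le (h : DiophantineMod lam γ τ) (hγ : 0 < γ) (hτ : τ ≤ θ)
    {p : Idx →₀ ℤ} (hlam : linearCombination ℤ lam p ≠ 0) (hmom : linearCombination ℤ mom p = 0)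
    (hk : 0 ≤ p + single k 1) : ‖linearCombination ℤ lam p‖⁻¹ ≤ γ⁻¹ * japProd p ^ θ := by
  have hDelta : p ∉ Delta lam := fun hp => by
    obtain ⟨j, hj⟩ := Set.mem_iUnion.mp hp
    exact hlam hj.1
  have hprod : p.prod (fun i n => 1 / (1 + (n : ℝ) ^ 2 * jap i ^ 2) ^ τ) = (japProd p ^ τ)⁻¹ := by
    rw [japProd, Finsupp.prod, Finsupp.prod, ← Real.finsetProd_rpow _ _ (fun i _ => by positivity),
      ← Finset.prod_inv_distrib]
    simp only [one_div]
  have hp := japProd_pos p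
  calc ‖linearCombination ℤ lam p‖⁻¹ ≤ (γ * (japProd p ^ τ)⁻¹)⁻¹ := by
        gcongr
        exact hprod ▸ h p hDelta hmom ⟨k, hk⟩
    _ = γ⁻¹ * japProd p ^ τ := by rw [mul_inv, inv_inv]
    _ ≤ γ⁻¹ * japProd p ^ θ := by
        gcongr
        exact one_le_japProd p

theorem DiophantineMod.inv_norm_linearCombination_le (h : DiophantineMod lam γ τ) (hγ : 0 < γ)
    (hτ : τ ≤ θ) (hlam : linearCombination ℕ lam q ≠ 0) (hmom : linearCombination ℕ mom q = 0) :
    ‖linearCombination ℕ lam q‖⁻¹ ≤ γ⁻¹ * japProd (toInt q) ^ θ := by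
  rw [← linearCombination_toInt] at hlam hmom ⊢
  refine h.inv_norm_le hγ hτ (k := (0, 1)) hlam hmom (add_nonneg (toInt_nonneg q) ?_)
  exact Finsupp.single_nonneg.mpr zero_le_one

theorem DiophantineMod.inv_norm_divisor_le (h : DiophantineMod lam γ τ) (hγ : 0 < γ) (hτ : τ ≤ θ)
    (hmom : linearCombination ℕ mom q = mom k) (hdiv : divisor lam k q ≠ 0) :
    ‖divisor lam k q‖⁻¹ ≤ γ⁻¹ * japProd (toInt q - single k 1) ^ θ := by
  rw [divisor, ← neg_sub, ← linearCombination_toInt_sub_single, neg_ne_zero] at hdiv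
  rw [divisor, ← neg_sub, ← linearCombination_toInt_sub_single, norm_neg]
  refine h.inv_norm_le hγ hτ (k := k) hdiv ?_ ?_
  · rw [linearCombination_toInt_sub_single, hmom, sub_self]
  · rw [sub_add_cancel]
    exact toInt_nonneg q

theorem norm_jap_sq_mul_exp (φ : ℝ) (k : Idx) :
    ‖(jap k : ℂ) ^ 2 * Complex.exp (Complex.I * φ)‖ = jap k ^ 2 := by
  rw [norm_mul, mul_comm Complex.I, Complex.norm_exp_ofReal_mul_I, mul_one, norm_pow,
    Complex.norm_real, Real.norm_of_nonneg (jap_pos k).le]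

theorem Superlinear.norm_le (h : Superlinear C lam) (k : Idx) : ‖lam k‖ ≤ 3 / 2 * jap k ^ 2 := by
  obtain ⟨φ, hφ, -⟩ := h
  have hsub := norm_le_norm_add_norm_sub' (lam k) (jap k ^ 2 * Complex.exp (Complex.I * φ k))
  rw [norm_jap_sq_mul_exp] at hsub
  linarith [hφ k, one_le_pow₀ (one_le_jap k) (n := 2)]

theorem Superlinear.ne_zero (h : Superlinear C lam) (k : Idx) : lam k ≠ 0 := by
  obtain ⟨φ, hφ, -⟩ := h
  intro h0
  have hk := hφ k
  rw [h0, zero_sub, norm_neg, norm_jap_sq_mul_exp] at hk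
  linarith [one_le_pow₀ (one_le_jap k) (n := 2)]

theorem Superlinear.norm_linearCombination_le (h : Superlinear C lam) (q : Idx →₀ ℕ) :
    ‖linearCombination ℕ lam q‖ ≤ 3 / 2 * sqrtWeight q ^ 4 := by
  have hjap : linearCombination ℕ (fun i => jap i ^ 2) q ≤ sqrtWeight q ^ 4 :=
    linearCombination_jap_pow_le q 1
  calc ‖linearCombination ℕ lam q‖ ≤ linearCombination ℕ (fun i => jap i ^ 2 * (3 / 2)) q :=
        norm_linearCombination_nat_le fun i => (h.norm_le i).trans_eq (mul_comm _ _)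
    _ = linearCombination ℕ (fun i => jap i ^ 2) q * (3 / 2) := linearCombination_nat_mul_const _ _
    _ ≤ 3 / 2 * sqrtWeight q ^ 4 := by linarith

theorem norm_phases_sub_le {φ : Idx → ℝ}
    (hφ : ∀ k, ‖lam k - (jap k : ℂ) ^ 2 * Complex.exp (Complex.I * φ k)‖ ≤ 1 / 2) (a k : Idx) :
    ‖(jap a : ℂ) ^ 2 * Complex.exp (Complex.I * φ a) -
      (jap k : ℂ) ^ 2 * Complex.exp (Complex.I * φ k)‖ ≤ ‖lam a - lam k‖ + 1 := by
  set u : Idx → ℂ := fun k => (jap k : ℂ) ^ 2 * Complex.exp (Complex.I * φ k)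
  calc ‖u a - u k‖ = ‖(lam a - lam k) - (lam a - u a) + (lam k - u k)‖ := by
        congr 1
        ring
    _ ≤ ‖lam a - lam k‖ + ‖lam a - u a‖ + ‖lam k - u k‖ :=
        (norm_add_le _ _).trans (add_le_add_left (norm_sub_le _ _) _)
    _ ≤ ‖lam a - lam k‖ + 1 := by linarith [hφ a, hφ k]

theorem Superlinear.abs_jap_sq_sub_le (h : Superlinear C lam) (a k : Idx) :
    |jap a ^ 2 - jap k ^ 2| ≤ ‖lam a - lam k‖ + 1 := by
  obtain ⟨φ, hφ, -⟩ := h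
  rw [← norm_jap_sq_mul_exp (φ a), ← norm_jap_sq_mul_exp (φ k)]
  exact (abs_norm_sub_norm_le _ _).trans (norm_phases_sub_le hφ a k)

theorem eq_neg_of_mom_eq (hne : a ≠ k) (hmom : mom a = mom k) : a = (-k.1, -k.2) := by
  obtain ⟨a₁, a₂⟩ := a
  obtain ⟨k₁, k₂⟩ := k
  simp only [mom] at hmom
  rcases Int.units_eq_one_or a₂ with rfl | rfl <;> rcases Int.units_eq_one_or k₂ with rfl | rfl <;>
    simp_all [neg_eq_iff_eq_neg]

theorem jap_neg (k : Idx) : jap (-k.1, -k.2) = jap k := by simp [jap]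

theorem Superlinear.mul_jap_sq_le (h : Superlinear C lam) (hne : lam a ≠ lam k)
    (hmom : mom a = mom k) : C * jap k ^ 2 ≤ ‖lam a - lam k‖ + 1 := by
  obtain ⟨φ, hφ, hsep⟩ := h
  obtain rfl := eq_neg_of_mom_eq (ne_of_apply_ne lam hne) hmom
  have hphase := norm_phases_sub_le hφ (-k.1, -k.2) k
  rw [jap_neg, ← mul_sub, norm_mul, norm_pow, Complex.norm_real, Real.norm_of_nonneg (jap_pos k).le,
    norm_sub_rev] at hphase
  calc C * jap k ^ 2 ≤ _ := by
        rw [mul_comm]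
        exact mul_le_mul_of_nonneg_left (hsep k.1 k.2 hne.symm) (sq_nonneg _)
    _ ≤ ‖lam (-k.1, -k.2) - lam k‖ + 1 := hphase

theorem jap_add_jap_le_abs_sq_sub_sq (h : jap a ≠ jap k) :
    jap a + jap k ≤ |jap a ^ 2 - jap k ^ 2| := by
  have hint (i : Idx) : jap i = (max |i.1| 1 : ℤ) := by simp [jap]
  have hone : 1 ≤ |jap a - jap k| := by
    rw [hint, hint] at h ⊢
    exact_mod_cast Int.one_le_abs (sub_ne_zero.mpr (by exact_mod_cast h))
  have hpos : 0 < jap a + jap k := add_pos (jap_pos a) (jap_pos k)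
  rw [sq_sub_sq, abs_mul, abs_of_pos hpos]
  exact le_mul_of_one_le_right hpos.le hone

theorem jap_le_norm_mom_sub (hjap : jap a = jap k) (hne : mom a ≠ mom k) :
    jap k ≤ ‖mom a - mom k‖ := by
  have hint (i : Idx) : jap i = (max |mom i| 1 : ℤ) := by
    rw [jap_eq_max_norm_mom, Int.norm_eq_abs]
    push_cast
    rfl
  rw [hint, hint] at hjap
  rw [hint, Int.norm_eq_abs]
  have hjap' : max |mom a| 1 = max |mom k| 1 := by exact_mod_cast hjap
  have hgoal : max |mom k| 1 ≤ |mom a - mom k| := by grind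
  exact_mod_cast hgoal

theorem Superlinear.jap_le (h : Superlinear C lam) (hC : 0 < C) {E : ℝ}
    (hlam : ‖lam a - lam k‖ + 1 ≤ E) (hmom : ‖mom a - mom k‖ ≤ E)
    (hne : ¬(lam a = lam k ∧ mom a = mom k)) : max (jap a) (jap k) ≤ (1 + C⁻¹) * E := by
  have hE : 0 ≤ E := (norm_nonneg _).trans hmom
  have hle : E ≤ (1 + C⁻¹) * E := le_mul_of_one_le_left hE (by simp [hC.le])
  by_cases hjap : jap a = jap k
  · rw [hjap, max_self]
    by_cases hmom' : mom a = mom k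
    · calc jap k ≤ jap k ^ 2 := le_self_pow₀ (one_le_jap k) two_ne_zero
        _ = C⁻¹ * (C * jap k ^ 2) := (inv_mul_cancel_left₀ hC.ne' _).symm
        _ ≤ C⁻¹ * E := by
            gcongr
            exact (h.mul_jap_sq_le (fun hl => hne ⟨hl, hmom'⟩) hmom').trans hlam
        _ ≤ (1 + C⁻¹) * E := by linarith
    · exact ((jap_le_norm_mom_sub hjap hmom').trans hmom).trans hle
  · have hsum : jap a + jap k ≤ E :=
      (jap_add_jap_le_abs_sq_sub_sq hjap).trans ((h.abs_jap_sq_sub_le a k).trans hlam)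
    exact (max_le (by linarith [jap_pos k]) (by linarith [jap_pos a])).trans hle

/-- The divisor is at most `1`, so `λ_a - λ_k` and `𝔪_a - 𝔪_k` are bounded in terms of `p`, and
the growth of `λ` then bounds `⟨a⟩` and `⟨k⟩` themselves. -/
theorem Superlinear.jap_le_of_norm_divisor_le_one (h : Superlinear C lam) (hC : 0 < C)
    (hmom : linearCombination ℕ mom (p + single a 1) = mom k)
    (hdiv : ‖divisor lam k (p + single a 1)‖ ≤ 1) (hne : ¬(lam a = lam k ∧ mom a = mom k)) :
    max (jap a) (jap k) ≤ 2 * (1 + C⁻¹) * (1 + sqrtWeight p ^ 4) := by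
  have hlam : ‖lam a - lam k‖ + 1 ≤ 2 * (1 + sqrtWeight p ^ 4) := by
    rw [divisor_add_single] at hdiv
    have hsub := norm_sub_norm_le (lam k - lam a) (linearCombination ℕ lam p)
    rw [norm_sub_rev (lam k)] at hsub
    linarith [h.norm_linearCombination_le p, show 0 ≤ sqrtWeight p ^ 4 by positivity]
  have hmom' : ‖mom a - mom k‖ ≤ 2 * (1 + sqrtWeight p ^ 4) := by
    rw [← hmom, map_add, Finsupp.linearCombination_single, one_smul, sub_add_cancel_right, norm_neg]
    have hjap : linearCombination ℕ jap p ≤ sqrtWeight p ^ 2 := by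
      simpa only [zero_add, pow_one, mul_one] using linearCombination_jap_pow_le p 0
    nlinarith [norm_linearCombination_nat_le (q := p) norm_mom_le_jap,
      sq_nonneg (sqrtWeight p ^ 2 - 1)]
  exact (h.jap_le hC hlam hmom' hne).trans_eq (by ring)

/-- The constant in front of the polynomial bound on an inverse divisor. -/
def divisorConst (C : ℝ) : ℝ := 16 * (2 * (1 + C⁻¹)) ^ 4

theorem one_le_divisorConst (hC : 0 < C) : 1 ≤ divisorConst C := by
  have hD : 1 ≤ 2 * (1 + C⁻¹) := by linarith [inv_pos.mpr hC]
  unfold divisorConst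
  linarith [one_le_pow₀ hD (n := 4)]

theorem japProd_toInt_sub_single_le {B : ℝ} (hB : max (jap a) (jap k) ≤ B) :
    japProd (toInt (p + single a 1) - single k 1) ≤ 16 * B ^ 4 * japProd (toInt p) := by
  have hsingle : toInt (single a 1) = single a 1 := Finsupp.mapRange_single ..
  have hp := japProd_pos (toInt p)
  have ha := jap_pos a
  have hk := jap_pos k
  obtain ⟨haB, hkB⟩ := max_le_iff.mp hB
  rw [toInt_add, hsingle, sub_eq_add_neg, ← Finsupp.single_neg]
  calc japProd (toInt p + single a 1 + single k (-1))
      ≤ 4 * jap k ^ 2 * (4 * jap a ^ 2 * japProd (toInt p)) :=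
        (japProd_add_single_le _ k (by norm_num)).trans
          (by gcongr; exact japProd_add_single_le _ a (by norm_num))
    _ ≤ 4 * B ^ 2 * (4 * B ^ 2 * japProd (toInt p)) := by gcongr
    _ = 16 * B ^ 4 * japProd (toInt p) := by ring

theorem inv_norm_divisor_le_rpow (hC : 0 < C) (hγ : 0 < γ) (hτ : τ ≤ θ) (hθ : 0 ≤ θ)
    (hS : Superlinear C lam) (hD : DiophantineMod lam γ τ)
    (hmom : linearCombination ℕ mom (p + single a 1) = mom k)
    (hdiv : divisor lam k (p + single a 1) ≠ 0) (hle : ‖divisor lam k (p + single a 1)‖ ≤ 1) :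
    ‖divisor lam k (p + single a 1)‖⁻¹ ≤
      γ⁻¹ * (divisorConst C * (1 + sqrtWeight p ^ 4) ^ 4 * japProd (toInt p)) ^ θ := by
  have hp := japProd_pos (toInt p)
  by_cases hres : lam a = lam k ∧ mom a = mom k
  · have hlc : divisor lam k (p + single a 1) = -linearCombination ℕ lam p := by
      rw [divisor_add_single, hres.1, sub_self, zero_sub]
    have hmom' : linearCombination ℕ mom p = 0 := by
      rwa [map_add, Finsupp.linearCombination_single, one_smul, hres.2, add_eq_right] at hmom
    have hone : 1 ≤ divisorConst C * (1 + sqrtWeight p ^ 4) ^ 4 :=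
      one_le_mul_of_one_le_of_one_le (one_le_divisorConst hC)
        (one_le_pow₀ (le_add_of_nonneg_right (by positivity)))
    rw [hlc, neg_ne_zero] at hdiv
    rw [hlc, norm_neg]
    refine (hD.inv_norm_linearCombination_le hγ hτ hdiv hmom').trans ?_
    gcongr
    exact le_mul_of_one_le_left hp.le hone
  · have hprod := japProd_toInt_sub_single_le (p := p)
      (hS.jap_le_of_norm_divisor_le_one hC hmom hle hres)
    refine (hD.inv_norm_divisor_le hγ hτ hmom hdiv).trans ?_
    gcongr
    · exact (japProd_pos _).le
    · exact hprod.trans_eq (by rw [divisorConst]; ring)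

/-- The constant `c` of the exponential loss `e^{c / σ⁶}`. -/
def lossConst (θ : ℝ) : ℝ := logConst θ * (∑' k, (jap k ^ 2)⁻¹) + logConst (4 * θ)

theorem lossConst_pos (hθ : 0 < θ) : 0 < lossConst θ :=
  add_pos_of_nonneg_of_pos
    (mul_nonneg (logConst_pos hθ).le (tsum_nonneg fun _ => by positivity))
    (logConst_pos (by positivity))

theorem rpow_mul_japProd_le {A σ : ℝ} (hA : 0 ≤ A) (hθ : 0 < θ) (hσ : 0 < σ) (p : Idx →₀ ℕ) :
    (A * (1 + sqrtWeight p ^ 4) ^ 4 * japProd (toInt p)) ^ θ ≤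
      A ^ θ * Real.exp (lossConst θ / σ ^ 6) * Real.exp (σ * (sqrtWeight p / 2)) := by
  have hweight : ((1 + sqrtWeight p ^ 4) ^ 4) ^ θ ≤
      Real.exp (σ / 4 * sqrtWeight p + logConst (4 * θ) / σ ^ 6) := by
    rw [← Real.rpow_natCast, ← Real.rpow_mul (by positivity)]
    exact rpow_one_add_sqrtWeight_pow_le (by positivity) hσ p
  rw [Real.mul_rpow (by positivity) (japProd_pos _).le, Real.mul_rpow hA (by positivity), mul_assoc,
    mul_assoc]
  refine mul_le_mul_of_nonneg_left ?_ (by positivity)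
  refine (mul_le_mul hweight (japProd_rpow_le hθ hσ p)
    (Real.rpow_nonneg (japProd_pos _).le _) (Real.exp_pos _).le).trans_eq ?_
  rw [← Real.exp_add, ← Real.exp_add, lossConst]
  ring_nf

theorem DiophantineMod.one_le_inv_gamma_mul (hD : DiophantineMod lam γ τ) (hγ : 0 < γ) (hτ : τ ≤ θ)
    (hS : Superlinear C lam) : 1 ≤ γ⁻¹ * (3 / 2 * 2 ^ θ) := by
  have hjap : jap (0, 1) = 1 := by simp [jap]
  have hinv := hD.inv_norm_linearCombination_le hγ hτ (q := single (0, 1) 1)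
    (by simpa using hS.ne_zero (0, 1)) (by simp [mom])
  have hprod : japProd (toInt (single (0, 1) 1)) = 2 := by
    rw [toInt, Finsupp.mapRange_single, japProd, Finsupp.prod_single_index (by simp), hjap]
    norm_num
  have hnorm := hS.norm_le (0, 1)
  rw [hjap] at hnorm
  rw [hprod, Finsupp.linearCombination_single, one_smul,
    inv_le_iff_one_le_mul₀ (norm_pos_iff.mpr (hS.ne_zero _))] at hinv
  calc (1 : ℝ) ≤ γ⁻¹ * 2 ^ θ * ‖lam (0, 1)‖ := hinv
    _ ≤ γ⁻¹ * 2 ^ θ * (3 / 2 * 1 ^ 2) := by gcongr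
    _ = γ⁻¹ * (3 / 2 * 2 ^ θ) := by ring

/-- Dividing a nonconstant monomial `x^q ∂_{x_k}` by its nonzero divisor costs at most the constant
`b` and a loss `σ` of the regularity `s`. -/
def DivisorBound (lam : Idx → ℂ) (σ b : ℝ) : Prop :=
  ∀ k q, q ≠ 0 → linearCombination ℕ mom q = mom k → divisor lam k q ≠ 0 →
    ‖divisor lam k q‖⁻¹ ≤ b * Real.exp (σ * (sqrtWeight q - √(jap k)))

theorem exists_divisorBound (τ : ℝ) (hC : 0 < C) :
    ∃ c K : ℝ, 0 < c ∧ 1 ≤ K ∧ ∀ (lam : Idx → ℂ) (γ : ℝ), 0 < γ → Superlinear C lam →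
      DiophantineMod lam γ τ → ∀ σ, 0 < σ →
        DivisorBound lam σ (K * γ⁻¹ * Real.exp (c / σ ^ 6)) := by
  set θ := max τ 1
  have hτ : τ ≤ θ := le_max_left _ _
  have hθ : 0 < θ := one_pos.trans_le (le_max_right _ _)
  have hA : 1 ≤ divisorConst C := one_le_divisorConst hC
  have hc := lossConst_pos hθ
  have hAθ : 1 ≤ divisorConst C ^ θ := Real.one_le_rpow hA hθ.le
  have hgam : 0 ≤ 3 / 2 * (2 : ℝ) ^ θ := by positivity
  refine ⟨lossConst θ, divisorConst C ^ θ + 3 / 2 * 2 ^ θ, hc, by linarith,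
    fun lam γ hγ hS hD σ hσ k q hq hmom hdiv => ?_⟩
  obtain ⟨a, p, rfl, hmax⟩ := exists_eq_add_single_max hq
  set gain := sqrtWeight (p + single a 1) - √(jap k)
  have hgain : sqrtWeight p / 2 ≤ gain := half_sqrtWeight_le hmax hmom
  rcases le_total ‖divisor lam k (p + single a 1)‖ 1 with hle | hge
  · calc ‖divisor lam k (p + single a 1)‖⁻¹
        ≤ γ⁻¹ * (divisorConst C * (1 + sqrtWeight p ^ 4) ^ 4 * japProd (toInt p)) ^ θ :=
          inv_norm_divisor_le_rpow hC hγ hτ hθ.le hS hD hmom hdiv hle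
      _ ≤ γ⁻¹ * (divisorConst C ^ θ * Real.exp (lossConst θ / σ ^ 6) * Real.exp (σ * gain)) := by
          refine mul_le_mul_of_nonneg_left ?_ (inv_pos.mpr hγ).le
          refine (rpow_mul_japProd_le (by linarith) hθ hσ p).trans ?_
          gcongr
      _ = divisorConst C ^ θ * γ⁻¹ * Real.exp (lossConst θ / σ ^ 6) * Real.exp (σ * gain) := by
          ring
      _ ≤ _ := by
          gcongr
          exact le_add_of_nonneg_right hgam
  · have hgain0 : 0 ≤ gain := by linarith [sqrtWeight_nonneg p]
    calc ‖divisor lam k (p + single a 1)‖⁻¹ ≤ 1 := inv_le_one_of_one_le₀ hge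
      _ ≤ γ⁻¹ * (3 / 2 * 2 ^ θ) := hD.one_le_inv_gamma_mul hγ hτ hS
      _ = 3 / 2 * 2 ^ θ * γ⁻¹ * 1 * 1 := by ring
      _ ≤ _ := by
          gcongr
          · exact le_add_of_nonneg_left (by linarith)
          · exact Real.one_le_exp (by positivity)
          · exact Real.one_le_exp (by positivity)

end SmallDivisors

/-! ### The estimate of the solution -/

section Estimate

variable {s r σ b : ℝ} {V : FormalVF}

theorem OrderGE.cf_zero {d : ℕ} (hV : OrderGE d V) (k : Idx) : cf V k 0 = 0 := by
  by_contra h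
  simpa using hV k 0 h

theorem DivisorBound.majNorm_divLam_le (h : DivisorBound lam σ b) (hr : 0 < r)
    (hV : MomentumPreserving V) (h0 : ∀ k, cf V k 0 = 0) :
    majNorm (s + σ) r (divLam lam V) ≤ ENNReal.ofReal b * majNorm s r V := by
  refine majNorm_add_le_of_coeff_le hr fun k q => ?_
  by_cases hdiv : divisor lam k q = 0
  · rw [cf_divLam, hdiv, div_zero, enorm_zero, mul_zero]
    exact zero_le
  by_cases hcf : cf V k q = 0
  · rw [cf_divLam, hcf, zero_div, enorm_zero, mul_zero]
    exact zero_le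
  have hq : q ≠ 0 := by
    rintro rfl
    exact hcf (h0 k)
  have hexp : Real.exp (σ * √(jap k)) * ‖divisor lam k q‖⁻¹ ≤
      b * Real.exp (σ * sqrtWeight q) := by
    refine (mul_le_mul_of_nonneg_left (h k q hq (hV k q hcf) hdiv) (Real.exp_pos _).le).trans_eq ?_
    rw [mul_left_comm, ← Real.exp_add]
    ring_nf
  rw [evalMonomial_expWeight, expWeight, cf_divLam, div_eq_inv_mul, enorm_mul, ← mul_assoc,
    ← mul_assoc, ← ENNReal.ofReal_mul' (Real.exp_pos _).le, ← ofReal_norm (divisor lam k q)⁻¹,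
    norm_inv, ← ENNReal.ofReal_mul (Real.exp_pos _).le]
  gcongr

theorem majNorm_add_le_self (hσ : 0 ≤ σ) (hr : 0 < r) (hV : MomentumPreserving V)
    (h0 : ∀ k, cf V k 0 = 0) : majNorm (s + σ) r V ≤ majNorm s r V := by
  rw [← one_mul (majNorm s r V)]
  refine majNorm_add_le_of_coeff_le hr fun k q => ?_
  by_cases hcf : cf V k q = 0
  · simp [hcf]
  have hq : q ≠ 0 := by
    rintro rfl
    exact hcf (h0 k)
  rw [one_mul, evalMonomial_expWeight, expWeight]
  gcongr
  exact sqrt_jap_le_sqrtWeight_of_mom_eq hq (hV k q hcf)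

theorem majNorm_proj_le (hr : 0 < r) (J : Set (Idx →₀ ℕ)) :
    majNorm s r (proj J V) ≤ majNorm s r V :=
  majNorm_mono hr fun k q => by
    by_cases hq : q ∈ J
    · rw [cf_proj_of_mem hq]
    · simp [cf_proj_of_notMem hq]

variable {i : Fin 2} {d : ℕ} {Y Z : FormalVF} {ρ : ℝ}

theorem majNorm_homSol_le (hb : DivisorBound lam σ b) (hY : IdealField lam i d Y)
    (hZ : MomentumPreserving Z) (hZ0 : ∀ k, cf Z k 0 = 0) (hσ : 0 ≤ σ) (hρ : 0 < ρ) (hρr : ρ < r)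
    (hYfin : majNorm s r Y < ⊤) (hZfin : majNorm s r Z < ⊤) :
    majNorm (s + σ + σ) (r - ρ) (homSol lam i Z Y) ≤ ENNReal.ofReal b * (majNorm s r Y +
      ENNReal.ofReal (r / ρ) * (ENNReal.ofReal b * majNorm s r Y * majNorm s r Z)) := by
  have hr : 0 < r := hρ.trans hρr
  have hr' : 0 < r - ρ := sub_pos.mpr hρr
  have hW := hY.sub (hY.divLam.transport hZ)
  have hYr : majNorm s (r - ρ) Y ≤ majNorm s r Y :=
    majNorm_le_of_radius_le hr' (by linarith) hY.orderGE.cf_zero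
  have hZs : majNorm (s + σ) r Z ≤ majNorm s r Z := majNorm_add_le_self hσ hr hZ hZ0
  have hL : majNorm (s + σ) (r - ρ) (divLam lam Y) ≤ ENNReal.ofReal b * majNorm s r Y :=
    (hb.majNorm_divLam_le hr' hY.momentum hY.orderGE.cf_zero).trans (by gcongr)
  have hLfin : majNorm (s + σ) (r - ρ) (divLam lam Y) < ⊤ :=
    hL.trans_lt (ENNReal.mul_lt_top ENNReal.ofReal_lt_top hYfin)
  have hT : majNorm (s + σ) (r - ρ) (transport lam i Z (divLam lam Y)) ≤
      ENNReal.ofReal (r / ρ) * (ENNReal.ofReal b * majNorm s r Y * majNorm s r Z) :=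
    (majNorm_proj_le hr' _).trans <|
      (majNorm_applyField_le hρ hρr hLfin (hZs.trans_lt hZfin)).trans (by gcongr)
  calc majNorm (s + σ + σ) (r - ρ) (homSol lam i Z Y)
      ≤ ENNReal.ofReal b * majNorm (s + σ) (r - ρ) (Y - transport lam i Z (divLam lam Y)) :=
        hb.majNorm_divLam_le hr' hW.momentum hW.orderGE.cf_zero
    _ ≤ _ := by
        gcongr
        refine (majNorm_sub_le hr' _ _).trans (add_le_add ?_ hT)
        exact (majNorm_add_le_self hσ hr' hY.momentum hY.orderGE.cf_zero).trans hYr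

theorem exp_div_half_pow_six_sq (c σ : ℝ) :
    Real.exp (c / (σ / 2) ^ 6) ^ 2 = Real.exp (2 ^ 7 * c / σ ^ 6) := by
  rw [← Real.exp_nat_mul, div_pow, div_div_eq_mul_div]
  ring_nf

/-- The loss `σ` is split evenly between the two divisions. -/
theorem majNorm_homSol_le_of_divisorBound {c K γ : ℝ} (hc : 0 ≤ c) (hK : 1 ≤ K) (hγ : 0 < γ)
    (hdiv : ∀ σ, 0 < σ → DivisorBound lam σ (K * γ⁻¹ * Real.exp (c / σ ^ 6)))
    (hY : IdealField lam i d Y) (hZ : MomentumPreserving Z) (hZ0 : ∀ k, cf Z k 0 = 0)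
    (hσ : 0 < σ) (hρ : 0 < ρ) (hρr : ρ < r)
    (hYfin : majNorm s r Y < ⊤) (hZfin : majNorm s r Z < ⊤) :
    majNorm (s + σ) (r - ρ) (homSol lam i Z Y) ≤
      ENNReal.ofReal (K ^ 2 * (r / ρ) * γ⁻¹ * Real.exp (2 ^ 7 * c / σ ^ 6)) *
        (1 + ENNReal.ofReal γ⁻¹ * majNorm s r Z) * majNorm s r Y := by
  have hrρ : 1 ≤ r / ρ := (one_le_div hρ).mpr hρr.le
  rw [← exp_div_half_pow_six_sq]
  set e := Real.exp (c / (σ / 2) ^ 6)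
  have he : 1 ≤ e := Real.one_le_exp (by positivity)
  set b := K * γ⁻¹ * e
  set B := K ^ 2 * (r / ρ) * γ⁻¹ * e ^ 2
  have hb : 0 ≤ b := by positivity
  have hB : 0 ≤ B := by positivity
  have hbB : b ≤ B :=
    calc b = K * 1 * γ⁻¹ * e := by rw [mul_one]
      _ ≤ K ^ 2 * (r / ρ) * γ⁻¹ * e ^ 2 := by
        gcongr
        · exact le_self_pow₀ hK two_ne_zero
        · exact le_self_pow₀ he two_ne_zero
  have hbb : b * (r / ρ * b) = B * γ⁻¹ := by ring
  have hbb' : ENNReal.ofReal b * (ENNReal.ofReal (r / ρ) * ENNReal.ofReal b) =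
      ENNReal.ofReal B * ENNReal.ofReal γ⁻¹ := by
    rw [← ENNReal.ofReal_mul (by positivity), ← ENNReal.ofReal_mul hb, hbb, ENNReal.ofReal_mul hB]
  have hle := majNorm_homSol_le (hdiv (σ / 2) (half_pos hσ)) hY hZ hZ0 (half_pos hσ).le hρ hρr
    hYfin hZfin
  rw [add_assoc, add_halves] at hle
  calc majNorm (s + σ) (r - ρ) (homSol lam i Z Y)
      ≤ ENNReal.ofReal b * (majNorm s r Y +
          ENNReal.ofReal (r / ρ) * (ENNReal.ofReal b * majNorm s r Y * majNorm s r Z)) := hle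
    _ = ENNReal.ofReal b * majNorm s r Y + ENNReal.ofReal b *
          (ENNReal.ofReal (r / ρ) * ENNReal.ofReal b) * majNorm s r Z * majNorm s r Y := by ring
    _ ≤ ENNReal.ofReal B * majNorm s r Y +
          ENNReal.ofReal B * ENNReal.ofReal γ⁻¹ * majNorm s r Z * majNorm s r Y := by
        rw [hbb']
        exact add_le_add_left (mul_le_mul_left (ENNReal.ofReal_le_ofReal hbB) _) _
    _ = _ := by ring

end Estimate

end ResVF

end

open ResVF in
theorem proposition4p1_general (τ : ℝ) {C : ℝ} (hC : 0 < C) :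
    ∃ c K : ℝ, 0 < c ∧ 0 < K ∧ ∀ (lam : Idx → ℂ) (γ : ℝ), 0 < γ → Superlinear C lam →
      DiophantineMod lam γ τ → ∀ Mst : ℕ, IsThreshold lam Mst → ∀ (s r : ℝ) (Z : FormalVF),
      MemV s r Z → Resonant lam Z → Diagonal Z → OrderGE 1 Z → ∀ (i : Fin 2) (Y : FormalVF),
      MemV s r Y → InIdeal lam i Y → OrderGE Mst Y → ∃ F : FormalVF,
        (∀ G, MomentumPreserving G → InIdeal lam i G → OrderGE Mst G →
          proj (idealExp lam i) (lie G (diagField lam + Z)) = Y → G = F) ∧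
        ∀ σ ρ : ℝ, 0 < σ → 0 < ρ → ρ < r →
          MemV (s + σ) (r - ρ) F ∧ InIdeal lam i F ∧ OrderGE Mst F ∧
          proj (idealExp lam i) (lie F (diagField lam + Z)) = Y ∧
          majNorm (s + σ) (r - ρ) F ≤
            ENNReal.ofReal (K * (r / ρ) * γ⁻¹ * Real.exp (2 ^ 7 * c / σ ^ 6)) *
              (1 + ENNReal.ofReal γ⁻¹ * majNorm s r Z) * majNorm s r Y := by
  obtain ⟨c, K, hc, hK, hdiv⟩ := exists_divisorBound τ hC
  refine ⟨c, K ^ 2, hc, by positivity,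
    fun lam γ hγ hS hD Mst hthr s r Z hZ hres hdiag hord i Y hY hYI hYord => ?_⟩
  have hZ' : ResonantDiagonal lam Z := .of_diagonal hZ.momentum hres hdiag hord
  have hY' : IdealField lam i Mst Y := ⟨hY.momentum, hYI, hYord⟩
  have hF : IdealField lam i Mst (homSol lam i Z Y) := hY'.homSol hZ.momentum
  refine ⟨homSol lam i Z Y, fun G hG hGI hGord =>
    (proj_lie_eq_iff_eq_homSol hthr hZ' ⟨hG, hGI, hGord⟩ hY').mp, fun σ ρ hσ hρ hρr => ?_⟩
  have hnorm := majNorm_homSol_le_of_divisorBound hc.le hK hγ (hdiv lam γ hγ hS hD) hY' hZ.momentum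
    hZ.zero hσ hρ hρr hY.finite hZ.finite
  have hfin : majNorm (s + σ) (r - ρ) (homSol lam i Z Y) < ⊤ :=
    hnorm.trans_lt <| ENNReal.mul_lt_top (ENNReal.mul_lt_top ENNReal.ofReal_lt_top <|
      ENNReal.add_lt_top.mpr ⟨ENNReal.one_lt_top, ENNReal.mul_lt_top ENNReal.ofReal_lt_top
        hZ.finite⟩) hY.finite
  exact ⟨⟨hF.orderGE.cf_zero, hF.momentum, hfin⟩, hF.inIdeal, hF.orderGE,
    (proj_lie_eq_iff_eq_homSol hthr hZ' hF hY').mpr rfl, hnorm⟩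

theorem proposition4p1 (τ C : ℝ) (hC : 0 < C) :
    ∃ c K : ℝ, 0 < c ∧ 0 < K ∧
      ∀ (lam : ResVF.Idx → ℂ) (M M₁ : ℕ) (γ : ℝ), 0 < M → 0 < γ →
        (∀ k, lam k ≠ 0) →
        ResVF.BoundedGenerators lam M M₁ →
        ResVF.Superlinear C lam →
        ResVF.DiophantineMod lam γ τ →
        ResVF.IsThreshold lam (2 * M + M₁) ∧
        ∀ Mst : ℕ, ResVF.IsThreshold lam Mst →
          ∀ (s r : ℝ), 0 ≤ s → 0 < r →
          ∀ Z : ResVF.FormalVF, ResVF.MemV s r Z → ResVF.Resonant lam Z → ResVF.Diagonal Z →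
            ResVF.OrderGE 1 Z →
          ∀ (i : Fin 2) (Y : ResVF.FormalVF), ResVF.MemV s r Y → ResVF.InIdeal lam i Y →
            ResVF.OrderGE Mst Y →
          ∃ F : ResVF.FormalVF, ∀ (σ ρ : ℝ), 0 < σ → 0 < ρ → ρ < r →
            (ResVF.MemV (s + σ) (r - ρ) F ∧ ResVF.InIdeal lam i F ∧ ResVF.OrderGE Mst F ∧
              ResVF.proj (ResVF.idealExp lam i)
                (ResVF.lie F (ResVF.diagField lam + Z)) = Y ∧
              ResVF.majNorm (s + σ) (r - ρ) F ≤
                ENNReal.ofReal (K * (r / ρ) * γ⁻¹ * Real.exp (2 ^ 7 * c / σ ^ 6)) *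
                  (1 + ENNReal.ofReal γ⁻¹ * ResVF.majNorm s r Z) * ResVF.majNorm s r Y) ∧
            ∀ G : ResVF.FormalVF, ResVF.MemV (s + σ) (r - ρ) G → ResVF.InIdeal lam i G →
              ResVF.OrderGE Mst G →
              ResVF.proj (ResVF.idealExp lam i)
                (ResVF.lie G (ResVF.diagField lam + Z)) = Y → G = F := by
  obtain ⟨c, K, hc, hK, hgen⟩ := proposition4p1_general τ hC
  refine ⟨c, K, hc, hK, fun lam M M₁ γ hM hγ _ hB hS hD =>
    ⟨ResVF.isThreshold_of_boundedGenerators hM hB,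
      fun Mst hthr s r _ _ Z hZ hres hdiag hord i Y hY hYI hYord => ?_⟩⟩
  obtain ⟨F, huniq, hF⟩ := hgen lam γ hγ hS hD Mst hthr s r Z hZ hres hdiag hord i Y hY hYI hYord
  exact ⟨F, fun σ ρ hσ hρ hρr => ⟨hF σ ρ hσ hρ hρr, fun G hG => huniq G hG.momentum⟩⟩
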